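/- For $n\ge 3$ and $\lambda>0$ define, for $x=(x_1,\dots,x_n)\in\mathbb R^n$ with Euclidean norm $|x|_2=(x_1^2+\dots+x_n^2)^{1/2}$, $$N_\lambda(x)=|x|_2\left(1+\lambda\,\frac{x_1^2+\dots+x_{n-1}^2-2x_n^2}{|x|_2^2}\right)^2\quad(x\ne0),\qquad N_\lambda(0)=0,$$ and put $$\alpha_n=\frac{\sqrt{18n^2-18n}-3n+1}{9n^2-12n-1}.$$ For $0<q\le 1$ let $L_q=L_q([0,1])$ (real-valued functions, Lebesgue measure) with $\|f\|_q=\left(\int_0^1|f|^q\right)^{1/q}$; a normed space $X$ is isometric to a subspace of $L_q$ if there is a linear map $T:X\to L_q$ with $\|Tx\|_q=\|x\|$ for all $x\in X$. **Theorem 1.** Let $n\ge3$. Then $\alpha_n<\frac1{6n-4}$, and for every $\lambda$ with $$\alpha_n<\lambda\le\frac1{6n-4}$$ the function $N_\lambda$ is a norm on $\mathbb R^n$, and the $n$-dimensional Banach space $X_\lambda=(\mathbb R^n,N_\lambda)$ is isometric to a subspace of $L_{1/2}$ but not isometric to a subspace of $L_1$. More precisely, for every $0<\lambda\le\frac1{11}$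 the function $N_\lambda$ is a norm on $\mathbb R^n$, and $X_\lambda=(\mathbb R^n,N_\lambda)$ is isometric to a subspace of $L_{1/2}$ if and only if $\lambda\le\frac1{6n-4}$, and isometric to a subspace of $L_1$ if and only if $\lambda\le\alpha_n$. -/

import Mathlib

open MeasureTheory
open scoped ENNReal

noncomputable section

/-- The perturbation of the Euclidean norm on `ℝⁿ`,
`N_λ(x) = |x|₂ (1 + λ (x₁² + ⋯ + xₙ₋₁² - 2 xₙ²) / |x|₂²)²`.
The indices `0, …, n - 1` of `Fin n` stand for `1, …, n`, so the weight `-2` sits on the last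
coordinate; at `x = 0` the value is `0`. -/
def spoiledNorm (n : ℕ) (lam : ℝ) (x : Fin n → ℝ) : ℝ :=
  √(∑ i, x i ^ 2) *
    (1 + lam * ((∑ i : Fin n, (if (i : ℕ) + 1 = n then -2 else 1) * x i ^ 2) / ∑ i, x i ^ 2)) ^ 2

/-- The vector space `ℝⁿ`, to be equipped with `N_λ` (and not with the sup norm of `Fin n → ℝ`). -/
def SpoiledSpace (n : ℕ) (_lam : ℝ) : Type := Fin n → ℝ

instance (n : ℕ) (lam : ℝ) : AddCommGroup (SpoiledSpace n lam) :=
  inferInstanceAs (AddCommGroup (Fin n → ℝ))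

instance (n : ℕ) (lam : ℝ) : Module ℝ (SpoiledSpace n lam) :=
  inferInstanceAs (Module ℝ (Fin n → ℝ))

/-- `‖x‖ = N_λ(x)`. This is only notation; that `N_λ` satisfies the axioms of a norm is the
statement `NormedSpace.Core ℝ (SpoiledSpace n lam)`. -/
instance (n : ℕ) (lam : ℝ) : Norm (SpoiledSpace n lam) :=
  ⟨fun x => spoiledNorm n lam x⟩

/-- `E` is isometric to a linear subspace of the real space `L_p = L_p([0,1])` with Lebesgue
measure, where `‖f‖ = (∫ |f|^p)^(1/p)` also for `p < 1`: there is a linear map `E → L_p` which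
preserves `‖·‖`. -/
def IsometricToSubspaceOfLp (p : ℝ≥0∞) (E : Type*) [AddCommGroup E] [Module ℝ E] [Norm E] :
    Prop :=
  ∃ T : E →ₗ[ℝ] Lp ℝ p (volume.restrict (Set.Icc (0 : ℝ) 1)), ∀ x : E, ‖T x‖ = ‖x‖

/-- `α_n = (√(18n² - 18n) - 3n + 1) / (9n² - 12n - 1)`. -/
def alphaBound (n : ℕ) : ℝ :=
  (√(18 * (n : ℝ) ^ 2 - 18 * n) - 3 * n + 1) / (9 * (n : ℝ) ^ 2 - 12 * n - 1)

end

noncomputable section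

/-! Write `t = xₙ² / |x|²`. The norm is `|x| (1 + λ (1 - 3t))²`, so `N_λ ^ q` is `|x| ^ q` times a
polynomial in `t`, of degree one for `q = 1/2` and two for `q = 1`. Gaussian averages of `|⟨x, y⟩| ^
q` against the quadratic forms `∑ vᵢ yᵢ²` and their squares are of the same shape. Matching
coefficients gives `N_λ(x) ^ q` as a constant times `∫ |⟨x, y⟩| ^ q |y| ^ (2m) f(τ) exp(-|y|²/2)
dy`, with `τ = yₙ² / |y|²` and `f` an explicit polynomial (`integral_halfDensity`,
`integral_oneDensity`).

If `f ≥ 0` on `[0, 1]`, this is integration against a finite measure, which can be realised as the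
law of a random vector on `[0, 1]`; that yields the embedding
(`isometricToSubspaceOfLp_of_measure`).

Conversely, an embedding is a random vector `ξ` representing `N_λ ^ q`. Averaging both
representations over Gaussian `x` with variance `1 + s` on the last axis gives equal integrals of
`(1 + sτ) ^ (q/2)`. Since `q/2` is not a natural number, derivatives at `s = 0` recover all moments
of `τ`, so the signed weight `f(τ)` has nonnegative moments. High powers of `τ` concentrate at the
pole `τ = 1`, which forces `f(1) ≥ 0` (`density_nonneg_at_pole`).

For both exponents `f(1) ≥ 0` already makes `f` nonnegative on `[0, 1]`, so the criterion is exactly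
`f(1) ≥ 0`: a linear condition on `λ` for `q = 1/2`, a quadratic one with positive root `α_n` for `q
= 1`.

The triangle inequality reduces to a homogeneous function of `(|x'|, |xₙ|)` that is monotone and
convex in the quadrant when `λ ≤ 1/11` (`planarNorm_mono`, `planarNorm_add_le`). -/

/-! ### Embeddings into `L_q([0,1])` and representing measures -/

theorem Lp_norm_rpow_eq_integral {α : Type*} [MeasurableSpace α] {μ : Measure α} {p : ℝ≥0∞}
    (hp0 : p ≠ 0) (hp : p ≠ ∞) (f : Lp ℝ p μ) :
    ‖f‖ ^ p.toReal = ∫ a, |f a| ^ p.toReal ∂μ := by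
  have hq : 0 < p.toReal := ENNReal.toReal_pos hp0 hp
  have h0 : 0 ≤ ∫ a, ‖f a‖ ^ p.toReal ∂μ := integral_nonneg fun a => by positivity
  rw [Lp.norm_def, (Lp.memLp f).eLpNorm_eq_integral_rpow_norm hp0 hp,
    ENNReal.toReal_ofReal (by positivity), ← Real.rpow_mul h0, inv_mul_cancel₀ hq.ne',
    Real.rpow_one]
  rfl

theorem spoiledNorm_nonneg (n : ℕ) (lam : ℝ) (x : Fin n → ℝ) : 0 ≤ spoiledNorm n lam x := by
  unfold spoiledNorm; positivity

theorem exists_measurable_map_restrict_Icc_eq {Y : Type*} [Nonempty Y] [MeasurableSpace Y]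
    [StandardBorelSpace Y] (μ : Measure Y) [IsProbabilityMeasure μ] :
    ∃ φ : ℝ → Y, Measurable φ ∧ (volume.restrict (Set.Icc (0 : ℝ) 1)).map φ = μ := by
  obtain ⟨f, hf, hfμ⟩ := μ.exists_measurable_map_eq
  refine ⟨f ∘ Set.projIcc 0 1 zero_le_one,
    hf.comp continuous_projIcc.measurable, ?_⟩
  have h1 : (volume.restrict (Set.Icc (0 : ℝ) 1)) =
      (volume : Measure unitInterval).map Subtype.val :=
    (map_comap_subtype_coe measurableSet_Icc volume).symm
  rw [h1, Measure.map_map (hf.comp continuous_projIcc.measurable) measurable_subtype_coe, ← hfμ]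
  congr 1
  ext t
  simp [Set.projIcc_val]

/-- Normalise `μ` to a probability measure, realise it as the law of `φ` on `[0, 1]`, and send `x`
to a multiple of `⟨x, φ⟩`. -/
theorem isometricToSubspaceOfLp_of_measure {n : ℕ} {lam : ℝ} {p : ℝ≥0∞} (hp0 : p ≠ 0)
    (hp : p ≠ ∞) (μ : Measure (Fin n → ℝ)) [IsFiniteMeasure μ]
    (hint : ∀ x : Fin n → ℝ, Integrable (fun y => |∑ i, x i * y i| ^ p.toReal) μ)
    (h : ∀ x : Fin n → ℝ,
      ∫ y, |∑ i, x i * y i| ^ p.toReal ∂μ = spoiledNorm n lam x ^ p.toReal) :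
    IsometricToSubspaceOfLp p (SpoiledSpace n lam) := by
  have hq : 0 < p.toReal := ENNReal.toReal_pos hp0 hp
  have key : ∀ (x : SpoiledSpace n lam) (f : Lp ℝ p (volume.restrict (Set.Icc (0 : ℝ) 1))),
      ∫ a, |f a| ^ p.toReal ∂(volume.restrict (Set.Icc (0 : ℝ) 1))
        = spoiledNorm n lam x ^ p.toReal → ‖f‖ = ‖x‖ := by
    intro x f hf
    rw [← Lp_norm_rpow_eq_integral hp0 hp] at hf
    exact (Real.rpow_left_inj (by rw [Lp.norm_def]; positivity) (spoiledNorm_nonneg n lam x) hq.ne').1 hf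
  -- The zero measure cannot be normalised; there every norm vanishes and the zero map serves.
  by_cases hμ : μ = 0
  · refine ⟨0, fun x => key x _ ?_⟩
    rw [← h x, hμ, integral_zero_measure, ← Lp_norm_rpow_eq_integral hp0 hp]
    simp [hq.ne']
  set M : ℝ := μ.real Set.univ with hM
  have : NeZero μ := ⟨hμ⟩
  have hM0 : 0 < M := measureReal_univ_pos
  obtain ⟨φ, hφ, hmap⟩ := exists_measurable_map_restrict_Icc_eq ((μ Set.univ)⁻¹ • μ)
  -- Chosen so that the `q`-th power of `c` restores the mass lost in normalising.
  set c : ℝ := M ^ (p.toReal)⁻¹ with hc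
  have hc0 : 0 < c := by positivity
  have hcM : c ^ p.toReal = M := by
    rw [hc, ← Real.rpow_mul hM0.le, inv_mul_cancel₀ hq.ne', Real.rpow_one]
  have hmeasx : ∀ x : Fin n → ℝ, Measurable fun y : Fin n → ℝ => ∑ i, x i * y i := by
    intro x; fun_prop
  have hmem : ∀ x : Fin n → ℝ, MemLp (fun t => c * ∑ i, x i * φ t i) p
      (volume.restrict (Set.Icc (0 : ℝ) 1)) := by
    intro x
    refine MemLp.const_mul ?_ c
    have hm : AEStronglyMeasurable (fun t => ∑ i, x i * φ t i)
        (volume.restrict (Set.Icc (0 : ℝ) 1)) := ((hmeasx x).comp hφ).aestronglyMeasurable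
    rw [← integrable_norm_rpow_iff hm hp0 hp]
    have := (hint x).smul_measure (c := (μ Set.univ)⁻¹) (by simpa using hμ)
    rw [← hmap] at this
    exact this.comp_measurable hφ
  refine ⟨{ toFun := fun x => (hmem x).toLp, map_add' := ?_, map_smul' := ?_ }, fun x => key x _ ?_⟩
  · intro x y
    rw [← MemLp.toLp_add]
    refine MemLp.toLp_congr _ _ (Filter.Eventually.of_forall fun t => ?_)
    change c * ∑ i, (x i + y i) * φ t i = c * ∑ i, x i * φ t i + c * ∑ i, y i * φ t i
    simp only [add_mul, Finset.sum_add_distrib, mul_add]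
  · intro a x
    rw [RingHom.id_apply, ← MemLp.toLp_const_smul]
    refine MemLp.toLp_congr _ _ (Filter.Eventually.of_forall fun t => ?_)
    change c * ∑ i, (a * x i) * φ t i = a * (c * ∑ i, x i * φ t i)
    simp only [mul_assoc, ← Finset.mul_sum]
    ring
  · have h1 : ∀ᵐ a ∂(volume.restrict (Set.Icc (0 : ℝ) 1)),
        |(hmem x).toLp _ a| ^ p.toReal = M * |∑ i, x i * φ a i| ^ p.toReal := by
      filter_upwards [(hmem x).coeFn_toLp] with a ha
      rw [ha, abs_mul, Real.mul_rpow (abs_nonneg _) (abs_nonneg _), abs_of_pos hc0, hcM]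
    refine (integral_congr_ae h1).trans ?_
    have hae : AEStronglyMeasurable (fun y : Fin n → ℝ => |∑ i, x i * y i| ^ p.toReal)
        ((volume.restrict (Set.Icc (0 : ℝ) 1)).map φ) := by
      apply Measurable.aestronglyMeasurable; fun_prop
    rw [integral_const_mul, ← h x,
      ← integral_map (f := fun y : Fin n → ℝ => |∑ i, x i * y i| ^ p.toReal) hφ.aemeasurable hae,
      hmap, integral_smul_measure, ENNReal.toReal_inv, smul_eq_mul, ← measureReal_def, ← hM,
      mul_inv_cancel_left₀ hM0.ne']

/-- The coordinates of `ξ` are representatives of the images of the basis vectors; linearity of `T`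
then holds almost everywhere for each fixed `x`. -/
theorem IsometricToSubspaceOfLp.exists_representation {n : ℕ} {lam : ℝ} {p : ℝ≥0∞} (hp0 : p ≠ 0)
    (hp : p ≠ ∞) (h : IsometricToSubspaceOfLp p (SpoiledSpace n lam)) :
    ∃ ξ : ℝ → Fin n → ℝ, Measurable ξ ∧
      (∀ i, Integrable (fun t => |ξ t i| ^ p.toReal) (volume.restrict (Set.Icc (0 : ℝ) 1))) ∧
      ∀ x : Fin n → ℝ, ∫ t, |∑ i, x i * ξ t i| ^ p.toReal ∂(volume.restrict (Set.Icc (0 : ℝ) 1))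
        = spoiledNorm n lam x ^ p.toReal := by
  obtain ⟨T, hT⟩ := h
  let e : Fin n → SpoiledSpace n lam := fun i => (Pi.single i 1 : Fin n → ℝ)
  refine ⟨fun t i => T (e i) t, measurable_pi_lambda _ fun i => (Lp.stronglyMeasurable _).measurable,
    fun i => ?_, fun x => ?_⟩
  · exact (integrable_norm_rpow_iff (Lp.aestronglyMeasurable _) hp0 hp).2 (Lp.memLp (T (e i)))
  · have hx : (x : SpoiledSpace n lam) = ∑ i, x i • e i := by
      have := pi_eq_sum_univ' x
      refine this.trans ?_
      refine Finset.sum_congr rfl fun i _ => ?_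
      refine funext fun j => ?_
      change x i * _ = x i * (Pi.single i 1 : Fin n → ℝ) j
      simp [Pi.single_apply]
    have hTx : T x = ∑ i, x i • T (e i) := by
      conv_lhs => rw [hx]
      simp [map_sum]
    have hae : (T x : ℝ → ℝ) =ᵐ[volume.restrict (Set.Icc (0 : ℝ) 1)]
        fun t => ∑ i, x i * T (e i) t := by
      rw [hTx]
      have h1 := Lp.coeFn_finsetSum (s := Finset.univ) (f := fun i => x i • T (e i))
      have h2 : ∀ᵐ t ∂(volume.restrict (Set.Icc (0 : ℝ) 1)), ∀ i,
          (x i • T (e i) : Lp ℝ p _) t = x i * T (e i) t := by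
        rw [ae_all_iff]
        intro i
        filter_upwards [Lp.coeFn_smul (x i) (T (e i))] with t ht
        simpa using ht
      filter_upwards [h1, h2] with t ht1 ht2
      rw [ht1, Finset.sum_apply]
      exact Finset.sum_congr rfl fun i _ => ht2 i
    have h3 : ‖T x‖ ^ p.toReal = spoiledNorm n lam x ^ p.toReal := by rw [hT x]; rfl
    rw [← h3, Lp_norm_rpow_eq_integral hp0 hp]
    refine integral_congr_ae ?_
    filter_upwards [hae] with t ht
    rw [ht]

/-! ### Gaussian integrals of `|⟨x, y⟩| ^ q` -/

theorem integrable_exp_neg_mul_sum_sq (n : ℕ) {b : ℝ} (hb : 0 < b) :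
    Integrable fun y : Fin n → ℝ => Real.exp (-(b * ∑ i, y i ^ 2)) := by
  have h : Integrable fun y : Fin n → ℝ => ∏ i, Real.exp (-b * y i ^ 2) :=
    Integrable.fintype_prod (f := fun _ (v : ℝ) => Real.exp (-b * v ^ 2))
      fun _ => integrable_exp_neg_mul_sq hb
  refine h.congr (Filter.Eventually.of_forall fun y => ?_)
  simp only
  rw [← Real.exp_sum, ← Finset.mul_sum, neg_mul]

theorem pow_le_const_mul_exp (m : ℕ) {b r : ℝ} (hb : 0 < b) (hr : 0 ≤ r) :
    r ^ m ≤ m.factorial / b ^ m * Real.exp (b * r) := by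
  have h := Real.pow_div_factorial_le_exp (b * r) (by positivity) m
  rw [div_le_iff₀ (by positivity), mul_pow] at h
  rw [div_mul_eq_mul_div, le_div_iff₀ (by positivity)]
  linarith

theorem integrable_mul_exp_neg_of_le_pow {n : ℕ} {b c : ℝ} (m : ℕ) (hb : 0 < b)
    {f : (Fin n → ℝ) → ℝ} (hf : Measurable f) (hc : ∀ y, |f y| ≤ c * (1 + ∑ i, y i ^ 2) ^ m) :
    Integrable fun y => f y * Real.exp (-(b * ∑ i, y i ^ 2)) := by
  have hc0 : 0 ≤ c := by simpa using (abs_nonneg _).trans (hc 0)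
  set K : ℝ := m.factorial / (b / 2) ^ m
  refine ((integrable_exp_neg_mul_sum_sq n (half_pos hb)).const_mul
    (c * K * Real.exp (b / 2))).mono' (by apply Measurable.aestronglyMeasurable; fun_prop)
    (Filter.Eventually.of_forall fun y => ?_)
  have hr : 0 ≤ ∑ i, y i ^ 2 := by positivity
  rw [Real.norm_eq_abs, abs_mul, Real.abs_exp]
  calc |f y| * Real.exp (-(b * ∑ i, y i ^ 2))
      ≤ (c * (K * Real.exp (b / 2 * (1 + ∑ i, y i ^ 2)))) * Real.exp (-(b * ∑ i, y i ^ 2)) := by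
        gcongr
        refine (hc y).trans ?_
        gcongr
        exact pow_le_const_mul_exp m (half_pos hb) (by positivity)
    _ = c * K * Real.exp (b / 2) * Real.exp (-(b / 2 * ∑ i, y i ^ 2)) := by
        have : Real.exp (b / 2 * (1 + ∑ i, y i ^ 2)) * Real.exp (-(b * ∑ i, y i ^ 2))
            = Real.exp (b / 2) * Real.exp (-(b / 2 * ∑ i, y i ^ 2)) := by
          rw [← Real.exp_add, ← Real.exp_add]; ring_nf
        linear_combination c * K * this

theorem sq_sum_mul_le {n : ℕ} (x y : Fin n → ℝ) :
    (∑ i, x i * y i) ^ 2 ≤ (∑ i, x i ^ 2) * ∑ i, y i ^ 2 :=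
  Finset.sum_mul_sq_le_sq_mul_sq _ _ _

theorem abs_sum_mul_rpow_le {n : ℕ} (x y : Fin n → ℝ) {q : ℝ} (hq : 0 ≤ q) :
    |∑ i, x i * y i| ^ q ≤ (∑ i, x i ^ 2) ^ (q / 2) * (∑ i, y i ^ 2) ^ (q / 2) := by
  rw [← Real.mul_rpow (by positivity) (by positivity), ← Real.sqrt_sq_eq_abs, Real.sqrt_eq_rpow,
    ← Real.rpow_mul (by positivity), one_div_mul_eq_div]
  exact Real.rpow_le_rpow (by positivity) (sq_sum_mul_le x y) (by positivity)

theorem rpow_le_one_add {r s : ℝ} (hr : 0 ≤ r) (hs0 : 0 ≤ s) (hs : s ≤ 1) : r ^ s ≤ 1 + r :=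
  calc r ^ s ≤ (1 + r) ^ s := Real.rpow_le_rpow hr (by linarith) hs0
    _ ≤ (1 + r) ^ (1 : ℝ) := Real.rpow_le_rpow_of_exponent_le (by linarith) hs
    _ = 1 + r := Real.rpow_one _

/-- Rotation invariance: two vectors of equal length are exchanged by the reflection in the
hyperplane orthogonal to their difference, which preserves Lebesgue measure and the Gaussian weight.
-/
theorem integral_abs_sum_mul_rpow_congr {n : ℕ} {x x' : Fin n → ℝ} (q : ℝ)
    (h : ∑ i, x i ^ 2 = ∑ i, x' i ^ 2) :
    ∫ y : Fin n → ℝ, |∑ i, x i * y i| ^ q * Real.exp (-(1 / 2 * ∑ i, y i ^ 2)) =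
    ∫ y : Fin n → ℝ, |∑ i, x' i * y i| ^ q * Real.exp (-(1 / 2 * ∑ i, y i ^ 2)) := by
  have key : ∀ z : Fin n → ℝ,
      ∫ y : Fin n → ℝ, |∑ i, z i * y i| ^ q * Real.exp (-(1 / 2 * ∑ i, y i ^ 2)) =
      ∫ y : EuclideanSpace ℝ (Fin n), |inner ℝ (WithLp.toLp 2 z) y| ^ q *
        Real.exp (-(1 / 2 * ‖y‖ ^ 2)) := by
    intro z
    rw [← (PiLp.volume_preserving_toLp (Fin n)).integral_comp
      (MeasurableEquiv.toLp 2 (Fin n → ℝ)).measurableEmbedding]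
    refine integral_congr_ae (Filter.Eventually.of_forall fun y => ?_)
    simp only [EuclideanSpace.norm_sq_eq, PiLp.inner_apply, RCLike.inner_apply, conj_trivial,
      Real.norm_eq_abs, sq_abs]
    simp only [mul_comm]
  rw [key, key]
  set v : EuclideanSpace ℝ (Fin n) := WithLp.toLp 2 x
  set v' : EuclideanSpace ℝ (Fin n) := WithLp.toLp 2 x'
  have hv : ‖v‖ = ‖v'‖ := by
    rw [← sq_eq_sq₀ (norm_nonneg _) (norm_nonneg _), EuclideanSpace.norm_sq_eq,
      EuclideanSpace.norm_sq_eq]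
    simpa [v, v'] using h
  set U := Submodule.reflection (Submodule.span ℝ {v - v'})ᗮ
  have hU : U v = v' := Submodule.reflection_sub hv
  rw [← U.measurePreserving.integral_comp U.toHomeomorph.measurableEmbedding
    (fun y => |inner ℝ v' y| ^ q * Real.exp (-(1 / 2 * ‖y‖ ^ 2)))]
  simp only [← hU, LinearIsometryEquiv.inner_map_map, LinearIsometryEquiv.norm_map]

/-- By rotation invariance `x` may be replaced by `|x|` times a basis vector, and `|x| ^ q` factors
out. Only the positivity of `C` matters later, not its value. -/
theorem exists_integral_abs_sum_mul_rpow {n : ℕ} (hn : 0 < n) {q : ℝ} (hq : 0 < q) (hq1 : q ≤ 1) :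
    ∃ C : ℝ, 0 < C ∧ ∀ x : Fin n → ℝ,
      ∫ y : Fin n → ℝ, |∑ i, x i * y i| ^ q * Real.exp (-(1 / 2 * ∑ i, y i ^ 2)) =
        C * (∑ i, x i ^ 2) ^ (q / 2) := by
  let i₀ : Fin n := ⟨0, hn⟩
  refine ⟨∫ y : Fin n → ℝ, |y i₀| ^ q * Real.exp (-(1 / 2 * ∑ i, y i ^ 2)), ?_, fun x => ?_⟩
  · have hcont : Continuous fun y : Fin n → ℝ =>
        |y i₀| ^ q * Real.exp (-(1 / 2 * ∑ i, y i ^ 2)) := by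
      have : Continuous fun y : Fin n → ℝ => |y i₀| ^ q :=
        (continuous_abs.comp (continuous_apply i₀)).rpow_const fun _ => Or.inr hq.le
      fun_prop
    have hint : Integrable fun y : Fin n → ℝ =>
        |y i₀| ^ q * Real.exp (-(1 / 2 * ∑ i, y i ^ 2)) := by
      refine integrable_mul_exp_neg_of_le_pow (c := 2) 1 (by norm_num) (by fun_prop) fun y => ?_
      have h1 : y i₀ ^ 2 ≤ ∑ i, y i ^ 2 :=
        Finset.single_le_sum (f := fun i => y i ^ 2) (fun i _ => sq_nonneg _) (Finset.mem_univ i₀)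
      have h2 := rpow_le_one_add (abs_nonneg (y i₀)) hq.le hq1
      rw [abs_of_nonneg (by positivity)]
      nlinarith [sq_nonneg (|y i₀| - 1), sq_abs (y i₀)]
    rw [integral_pos_iff_support_of_nonneg (fun y => by positivity) hint]
    refine hcont.isOpen_support.measure_pos volume ⟨fun _ => 1, ?_⟩
    simp [Real.exp_ne_zero]
  · have h1 := integral_abs_sum_mul_rpow_congr (x := x)
      (x' := fun i => if i = i₀ then √(∑ i, x i ^ 2) else 0) q (by
        simp [Real.sq_sqrt (show 0 ≤ ∑ i, x i ^ 2 by positivity)])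
    rw [h1, mul_comm, ← integral_const_mul]
    refine integral_congr_ae (Filter.Eventually.of_forall fun y => ?_)
    simp only [ite_mul, zero_mul, Finset.sum_ite_eq', Finset.mem_univ, if_true]
    rw [abs_mul, Real.mul_rpow (by positivity) (by positivity), abs_of_nonneg (Real.sqrt_nonneg _),
      Real.sqrt_eq_rpow, ← Real.rpow_mul (by positivity), one_div_mul_eq_div, mul_assoc]

theorem integral_comp_mul_pi {n : ℕ} (D : Fin n → ℝ) (hD : ∀ i, 0 < D i) (f : (Fin n → ℝ) → ℝ) :
    ∫ y, f y = (∏ i, D i) * ∫ y : Fin n → ℝ, f (fun i => D i * y i) := by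
  have hdet : (Matrix.diagonal D).det = ∏ i, D i := Matrix.det_diagonal
  have hpos : 0 < ∏ i, D i := Finset.prod_pos fun i _ => hD i
  have hne : (Matrix.diagonal D).det ≠ 0 := hdet ▸ hpos.ne'
  have h := Real.smul_map_diagonal_volume_pi hne
  conv_lhs => rw [← h]
  let e : (Fin n → ℝ) ≃ᵐ (Fin n → ℝ) :=
    MeasurableEquiv.piCongrRight fun i => MeasurableEquiv.mulLeft₀ (D i) (hD i).ne'
  have he : (Matrix.toLin' (Matrix.diagonal D) : (Fin n → ℝ) → Fin n → ℝ) = e := by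
    ext y i
    simp [e, Matrix.toLin'_apply, Matrix.mulVec_diagonal, MeasurableEquiv.piCongrRight]
  rw [integral_smul_measure, he, e.measurableEmbedding.integral_map, hdet, abs_of_pos hpos,
    ENNReal.toReal_ofReal hpos.le]
  rfl

/-- Substitute `yᵢ / √wᵢ` for `yᵢ`. -/
theorem integral_abs_sum_mul_rpow_weighted {n : ℕ} {q C : ℝ}
    (hC : ∀ x : Fin n → ℝ,
      ∫ y : Fin n → ℝ, |∑ i, x i * y i| ^ q * Real.exp (-(1 / 2 * ∑ i, y i ^ 2)) =
        C * (∑ i, x i ^ 2) ^ (q / 2))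
    (w : Fin n → ℝ) (hw : ∀ i, 0 < w i) (x : Fin n → ℝ) :
    ∫ y : Fin n → ℝ, |∑ i, x i * y i| ^ q * Real.exp (-(1 / 2 * ∑ i, w i * y i ^ 2)) =
      C * (∏ i, (√(w i))⁻¹) * (∑ i, x i ^ 2 / w i) ^ (q / 2) := by
  have hs : ∀ i, 0 < √(w i) := fun i => Real.sqrt_pos.2 (hw i)
  rw [integral_comp_mul_pi (fun i => (√(w i))⁻¹) fun i => inv_pos.2 (hs i)]
  have h := hC fun i => x i * (√(w i))⁻¹
  have h1 : ∀ i, (x i * (√(w i))⁻¹) ^ 2 = x i ^ 2 / w i := fun i => by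
    rw [mul_pow, inv_pow, Real.sq_sqrt (hw i).le, div_eq_mul_inv]
  have h2 : ∀ (y : Fin n → ℝ) i, w i * ((√(w i))⁻¹ * y i) ^ 2 = y i ^ 2 := fun y i => by
    rw [mul_pow, inv_pow, Real.sq_sqrt (hw i).le, mul_inv_cancel_left₀ (hw i).ne']
  simp only [h1] at h
  simp only [h2, ← mul_assoc, h]
  ring

/-! ### Polynomial weights by differentiating in the covariance -/

theorem weighted_sq_sum_nonneg_le {n : ℕ} {v : Fin n → ℝ} (hv0 : ∀ i, 0 ≤ v i)
    (hv1 : ∀ i, v i ≤ 1) (y : Fin n → ℝ) :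
    0 ≤ ∑ i, v i * y i ^ 2 ∧ ∑ i, v i * y i ^ 2 ≤ ∑ i, y i ^ 2 :=
  ⟨Finset.sum_nonneg fun i _ => mul_nonneg (hv0 i) (sq_nonneg _),
    Finset.sum_le_sum fun i _ => mul_le_of_le_one_left (sq_nonneg _) (hv1 i)⟩

theorem sum_one_add_mul_sq {n : ℕ} (v y : Fin n → ℝ) (ε : ℝ) :
    ∑ i, (1 + ε * v i) * y i ^ 2 = (∑ i, y i ^ 2) + ε * ∑ i, v i * y i ^ 2 := by
  rw [Finset.mul_sum, ← Finset.sum_add_distrib]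
  exact Finset.sum_congr rfl fun i _ => by ring

/-- Each derivative in `ε` brings down a factor `-(1/2) ∑ vᵢ yᵢ²`. For `|ε| < 1/2` and `0 ≤ vᵢ ≤ 1`
all weights are at least `1/2`, so `exp(-|y|²/4)` times a polynomial dominates. -/
theorem hasDerivAt_integral_mul_exp {n : ℕ} {v : Fin n → ℝ} (hv0 : ∀ i, 0 ≤ v i)
    (hv1 : ∀ i, v i ≤ 1) {f : (Fin n → ℝ) → ℝ} (hf : Measurable f) {c : ℝ} {m : ℕ}
    (hc : ∀ y, |f y| ≤ c * (1 + ∑ i, y i ^ 2) ^ m) {ε : ℝ} (hε : ε ∈ Set.Ioo (-1 / 2 : ℝ) (1 / 2)) :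
    HasDerivAt (fun ε => ∫ y, f y * Real.exp (-(1 / 2 * ∑ i, (1 + ε * v i) * y i ^ 2)))
      (∫ y, f y * (-(1 / 2) * ∑ i, v i * y i ^ 2) *
        Real.exp (-(1 / 2 * ∑ i, (1 + ε * v i) * y i ^ 2))) ε := by
  have hexp : ∀ ε' ∈ Set.Ioo (-1 / 2 : ℝ) (1 / 2), ∀ y : Fin n → ℝ,
      Real.exp (-(1 / 2 * ∑ i, (1 + ε' * v i) * y i ^ 2)) ≤
        Real.exp (-(1 / 4 * ∑ i, y i ^ 2)) := by
    intro ε' hε' y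
    obtain ⟨h1, h2⟩ := weighted_sq_sum_nonneg_le hv0 hv1 y
    rw [Real.exp_le_exp, sum_one_add_mul_sq]
    nlinarith [hε'.1, hε'.2]
  have hint : Integrable fun y => (|f y| * (1 + ∑ i, y i ^ 2)) *
      Real.exp (-(1 / 4 * ∑ i, y i ^ 2)) := by
    refine integrable_mul_exp_neg_of_le_pow (c := c) (m + 1) (by norm_num) (by fun_prop) fun y => ?_
    have : 0 ≤ ∑ i, y i ^ 2 := by positivity
    rw [abs_mul, abs_abs, abs_of_nonneg (by positivity : 0 ≤ 1 + ∑ i, y i ^ 2), pow_succ,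
      ← mul_assoc]
    gcongr
    exact hc y
  refine (hasDerivAt_integral_of_dominated_loc_of_deriv_le
    (F := fun ε y => f y * Real.exp (-(1 / 2 * ∑ i, (1 + ε * v i) * y i ^ 2)))
    (F' := fun ε y => f y * (-(1 / 2) * ∑ i, v i * y i ^ 2) *
      Real.exp (-(1 / 2 * ∑ i, (1 + ε * v i) * y i ^ 2)))
    (isOpen_Ioo.mem_nhds hε) ?_ ?_ ?_ ?_ hint ?_).2
  · refine Filter.Eventually.of_forall fun ε' => ?_
    apply Measurable.aestronglyMeasurable; fun_prop
  · refine hint.mono' (by apply Measurable.aestronglyMeasurable; fun_prop)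
      (Filter.Eventually.of_forall fun y => ?_)
    have : 0 ≤ ∑ i, y i ^ 2 := by positivity
    rw [Real.norm_eq_abs, abs_mul, Real.abs_exp]
    refine mul_le_mul ?_ (hexp ε hε y) (Real.exp_nonneg _) (by positivity)
    nlinarith [abs_nonneg (f y)]
  · apply Measurable.aestronglyMeasurable; fun_prop
  · refine Filter.Eventually.of_forall fun y ε' hε' => ?_
    obtain ⟨h1, h2⟩ := weighted_sq_sum_nonneg_le hv0 hv1 y
    rw [Real.norm_eq_abs, abs_mul, abs_mul, Real.abs_exp]
    refine mul_le_mul (mul_le_mul_of_nonneg_left ?_ (abs_nonneg _)) (hexp ε' hε' y)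
      (Real.exp_nonneg _) (by positivity)
    rw [abs_mul, abs_of_nonneg h1]; norm_num; linarith
  · refine Filter.Eventually.of_forall fun y ε' _ => ?_
    simp only [sum_one_add_mul_sq]
    have h : HasDerivAt (fun ε : ℝ => -(1 / 2 * ((∑ i, y i ^ 2) + ε * ∑ i, v i * y i ^ 2)))
        (-(1 / 2) * ∑ i, v i * y i ^ 2) ε' := by
      have := (((hasDerivAt_id ε').mul_const (∑ i, v i * y i ^ 2)).const_add
        (∑ i, y i ^ 2)).const_mul (1 / 2 : ℝ) |>.neg
      refine this.congr_deriv (by ring)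
    exact (h.exp.const_mul (f y)).congr_deriv (by ring)

theorem abs_sum_mul_rpow_le_pow {n : ℕ} (x y : Fin n → ℝ) {q : ℝ} (hq : 0 < q) (hq1 : q ≤ 1) :
    |(|∑ i, x i * y i| ^ q)| ≤ (∑ i, x i ^ 2) ^ (q / 2) * (1 + ∑ i, y i ^ 2) ^ 1 := by
  rw [abs_of_nonneg (by positivity), pow_one]
  refine (abs_sum_mul_rpow_le x y hq.le).trans ?_
  gcongr
  exact rpow_le_one_add (by positivity) (by positivity) (by linarith)

theorem abs_mul_weighted_sq_sum_le {n : ℕ} {v : Fin n → ℝ} (hv0 : ∀ i, 0 ≤ v i)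
    (hv1 : ∀ i, v i ≤ 1) {f : (Fin n → ℝ) → ℝ} {c : ℝ} {m : ℕ}
    (hc : ∀ y, |f y| ≤ c * (1 + ∑ i, y i ^ 2) ^ m) (y : Fin n → ℝ) :
    |f y * ∑ i, v i * y i ^ 2| ≤ c * (1 + ∑ i, y i ^ 2) ^ (m + 1) := by
  obtain ⟨h1, h2⟩ := weighted_sq_sum_nonneg_le hv0 hv1 y
  rw [abs_mul, abs_of_nonneg h1, pow_succ, ← mul_assoc]
  have := (abs_nonneg _).trans (hc y)
  gcongr
  · exact hc y
  · linarith

/-- The logarithm of `∏ (1 + ε vᵢ)^(-1/2) (∑ xᵢ² / (1 + ε vᵢ))^(q/2)`. -/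
def logGaussianMoment {n : ℕ} (q : ℝ) (v x : Fin n → ℝ) (ε : ℝ) : ℝ :=
  -(1 / 2) * ∑ i, Real.log (1 + ε * v i) + q / 2 * Real.log (∑ i, x i ^ 2 / (1 + ε * v i))

/-- The derivative of `logGaussianMoment`. -/
def logGaussianMoment' {n : ℕ} (q : ℝ) (v x : Fin n → ℝ) (ε : ℝ) : ℝ :=
  -(1 / 2) * ∑ i, v i / (1 + ε * v i) +
    q / 2 * (-(∑ i, x i ^ 2 * v i / (1 + ε * v i) ^ 2) / ∑ i, x i ^ 2 / (1 + ε * v i))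

section

variable {n : ℕ} {v x : Fin n → ℝ} (hv0 : ∀ i, 0 ≤ v i) (hv1 : ∀ i, v i ≤ 1)
  (hx : 0 < ∑ i, x i ^ 2) {ε : ℝ} (hε : ε ∈ Set.Ioo (-1 / 2 : ℝ) (1 / 2))

include hv0 hv1 hε in
theorem one_add_mul_pos (i : Fin n) : 0 < 1 + ε * v i := by
  nlinarith [hv0 i, hv1 i, hε.1, hε.2]

include hv0 hv1 hε hx in
theorem sum_sq_div_one_add_pos : 0 < ∑ i, x i ^ 2 / (1 + ε * v i) := by
  have h : ∀ i, 0 ≤ x i ^ 2 / (1 + ε * v i) := fun i =>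
    div_nonneg (sq_nonneg _) (one_add_mul_pos hv0 hv1 hε i).le
  obtain ⟨i, hi, hxi⟩ := Finset.exists_lt_of_sum_lt (f := fun _ => (0 : ℝ)) (by simpa using hx)
  refine Finset.sum_pos' (fun i _ => h i) ⟨i, hi, div_pos hxi (one_add_mul_pos hv0 hv1 hε i)⟩

include hv0 hv1 hε in
theorem hasDerivAt_sq_div_one_add (i : Fin n) : HasDerivAt (fun ε => x i ^ 2 / (1 + ε * v i))
    (-(x i ^ 2 * v i / (1 + ε * v i) ^ 2)) ε := by
  have h0 := one_add_mul_pos hv0 hv1 hε i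
  have h := (((hasDerivAt_id ε).mul_const (v i)).const_add 1).inv h0.ne' |>.const_mul (x i ^ 2)
  refine (h.congr_deriv ?_).congr_of_eventuallyEq (Filter.Eventually.of_forall fun e => ?_)
  · simp only [id]; ring
  · simp [div_eq_mul_inv]

include hv0 hv1 hε hx in
theorem hasDerivAt_logGaussianMoment (q : ℝ) :
    HasDerivAt (logGaussianMoment q v x) (logGaussianMoment' q v x ε) ε := by
  refine HasDerivAt.add ?_ ?_
  · refine HasDerivAt.const_mul _ (HasDerivAt.fun_sum fun i _ => ?_)
    have := (((hasDerivAt_id ε).mul_const (v i)).const_add 1).log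
      (one_add_mul_pos hv0 hv1 hε i).ne'
    exact this.congr_deriv (by simp)
  · refine HasDerivAt.const_mul _ (HasDerivAt.log ?_ (sum_sq_div_one_add_pos hv0 hv1 hx hε).ne')
    rw [← Finset.sum_neg_distrib]
    exact HasDerivAt.fun_sum fun i _ => hasDerivAt_sq_div_one_add hv0 hv1 hε i

include hv0 hv1 hx in
theorem hasDerivAt_logGaussianMoment'_zero (q : ℝ) :
    HasDerivAt (logGaussianMoment' q v x)
      (1 / 2 * ∑ i, v i ^ 2 + q / 2 * (2 * (∑ i, v i ^ 2 * x i ^ 2) / (∑ i, x i ^ 2) -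
        ((∑ i, v i * x i ^ 2) / ∑ i, x i ^ 2) ^ 2)) 0 := by
  have h0 : (0 : ℝ) ∈ Set.Ioo (-1 / 2 : ℝ) (1 / 2) := by constructor <;> norm_num
  have hD : HasDerivAt (fun ε => ∑ i, x i ^ 2 / (1 + ε * v i)) (-∑ i, v i * x i ^ 2) 0 := by
    rw [← Finset.sum_neg_distrib]
    refine HasDerivAt.fun_sum fun i _ => (hasDerivAt_sq_div_one_add hv0 hv1 h0 i).congr_deriv ?_
    simp [mul_comm]
  have hinv : ∀ i, HasDerivAt (fun ε : ℝ => (1 + ε * v i)⁻¹) (-v i) 0 := fun i => by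
    have := (((hasDerivAt_id (0 : ℝ)).mul_const (v i)).const_add 1).inv (by simp)
    exact (this.congr_deriv (by simp))
  have hN : HasDerivAt (fun ε => -∑ i, x i ^ 2 * v i / (1 + ε * v i) ^ 2)
      (2 * ∑ i, v i ^ 2 * x i ^ 2) 0 := by
    rw [Finset.mul_sum, ← neg_neg (∑ i, 2 * (v i ^ 2 * x i ^ 2)), ← Finset.sum_neg_distrib]
    refine (HasDerivAt.fun_sum fun i _ => ?_).neg
    have := ((hinv i).pow 2).const_mul (x i ^ 2 * v i)
    refine (this.congr_deriv ?_).congr_of_eventuallyEq (Filter.Eventually.of_forall fun e => ?_)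
    · simp; ring
    · simp [div_eq_mul_inv]
  have hL : HasDerivAt (fun ε => ∑ i, v i / (1 + ε * v i)) (-∑ i, v i ^ 2) 0 := by
    rw [← Finset.sum_neg_distrib]
    refine HasDerivAt.fun_sum fun i _ => ?_
    refine (((hinv i).const_mul (v i)).congr_deriv (by ring)).congr_of_eventuallyEq
      (Filter.Eventually.of_forall fun e => ?_)
    simp [div_eq_mul_inv]
  have hD0 : ∑ i, x i ^ 2 / (1 + (0 : ℝ) * v i) ≠ 0 := by simpa using hx.ne'
  refine ((hL.const_mul (-(1 / 2))).add ((hN.div hD hD0).const_mul (q / 2))).congr_deriv ?_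
  simp only [zero_mul, add_zero, div_one, one_pow]
  field_simp
  simp only [mul_comm (x _ ^ 2)]
  ring

include hv0 hv1 hx hε in
theorem prod_mul_rpow_eq_exp_logGaussianMoment (q : ℝ) :
    (∏ i, (√(1 + ε * v i))⁻¹) * (∑ i, x i ^ 2 / (1 + ε * v i)) ^ (q / 2) =
      Real.exp (logGaussianMoment q v x ε) := by
  rw [logGaussianMoment, Real.exp_add,
    Real.rpow_def_of_pos (sum_sq_div_one_add_pos hv0 hv1 hx hε), mul_comm (Real.log _),
    Finset.mul_sum, Real.exp_sum]
  congr 1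
  refine Finset.prod_congr rfl fun i _ => ?_
  have h0 := one_add_mul_pos hv0 hv1 hε i
  rw [Real.sqrt_eq_rpow, ← Real.rpow_neg h0.le, Real.rpow_def_of_pos h0, mul_comm]

variable {q C : ℝ} (hq : 0 < q) (hq1 : q ≤ 1)
  (hC : ∀ x : Fin n → ℝ,
    ∫ y : Fin n → ℝ, |∑ i, x i * y i| ^ q * Real.exp (-(1 / 2 * ∑ i, y i ^ 2)) =
      C * (∑ i, x i ^ 2) ^ (q / 2))

-- Both sides are the `ε`-derivative of one function: on the left under the integral sign, on the
-- right from its closed form.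
include hv0 hv1 hx hε hq hq1 hC in
theorem integral_mul_weighted_sq_sum_mul_exp :
    ∫ y : Fin n → ℝ, |∑ i, x i * y i| ^ q * (-(1 / 2) * ∑ i, v i * y i ^ 2) *
        Real.exp (-(1 / 2 * ∑ i, (1 + ε * v i) * y i ^ 2)) =
      C * (Real.exp (logGaussianMoment q v x ε) * logGaussianMoment' q v x ε) := by
  have h1 := hasDerivAt_integral_mul_exp hv0 hv1
    (f := fun y => |∑ i, x i * y i| ^ q) (by fun_prop)
    (abs_sum_mul_rpow_le_pow x · hq hq1) hε
  have h2 := ((hasDerivAt_logGaussianMoment hv0 hv1 hx hε q).exp).const_mul C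
  refine h1.unique (h2.congr_of_eventuallyEq ?_)
  filter_upwards [isOpen_Ioo.mem_nhds hε] with e he
  rw [integral_abs_sum_mul_rpow_weighted hC _ (one_add_mul_pos hv0 hv1 he), mul_assoc,
    prod_mul_rpow_eq_exp_logGaussianMoment hv0 hv1 hx he]

include hx in
theorem exp_logGaussianMoment_zero :
    Real.exp (logGaussianMoment q v x 0) = (∑ i, x i ^ 2) ^ (q / 2) := by
  simp [logGaussianMoment, Real.rpow_def_of_pos hx, mul_comm]

include hv0 hv1 hx hq hq1 hC in
theorem integral_mul_weighted_sq_sum :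
    ∫ y : Fin n → ℝ, |∑ i, x i * y i| ^ q * (∑ i, v i * y i ^ 2) *
        Real.exp (-(1 / 2 * ∑ i, y i ^ 2)) =
      C * (∑ i, x i ^ 2) ^ (q / 2) *
        (∑ i, v i + q * ((∑ i, v i * x i ^ 2) / ∑ i, x i ^ 2)) := by
  have h := integral_mul_weighted_sq_sum_mul_exp hv0 hv1 hx (ε := 0)
    (by constructor <;> norm_num) hq hq1 hC
  rw [exp_logGaussianMoment_zero hx] at h
  have h3 : ∀ y : Fin n → ℝ, |∑ i, x i * y i| ^ q * (∑ i, v i * y i ^ 2) *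
        Real.exp (-(1 / 2 * ∑ i, y i ^ 2)) = (-2) * (|∑ i, x i * y i| ^ q *
        (-(1 / 2) * ∑ i, v i * y i ^ 2) *
        Real.exp (-(1 / 2 * ∑ i, (1 + 0 * v i) * y i ^ 2))) := fun y => by
    simp only [zero_mul, add_zero, one_mul]; ring
  simp only [h3]
  rw [integral_const_mul, h, logGaussianMoment']
  simp only [zero_mul, add_zero, div_one, one_pow, mul_comm (x _ ^ 2)]
  ring

-- Differentiate once more at `ε = 0`: with `L` the logarithm of the closed form, the second
-- derivative is `exp L * (L'² + L'')`, and the factor 4 undoes the two factors `-1/2`.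
include hv0 hv1 hx hq hq1 hC in
theorem integral_mul_weighted_sq_sum_sq :
    ∫ y : Fin n → ℝ, |∑ i, x i * y i| ^ q * (∑ i, v i * y i ^ 2) ^ 2 *
        Real.exp (-(1 / 2 * ∑ i, y i ^ 2)) =
      C * (∑ i, x i ^ 2) ^ (q / 2) *
        ((∑ i, v i + q * ((∑ i, v i * x i ^ 2) / ∑ i, x i ^ 2)) ^ 2 + 2 * ∑ i, v i ^ 2 +
          4 * q * ((∑ i, v i ^ 2 * x i ^ 2) / ∑ i, x i ^ 2) -
          2 * q * ((∑ i, v i * x i ^ 2) / ∑ i, x i ^ 2) ^ 2) := by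
  have h0 : (0 : ℝ) ∈ Set.Ioo (-1 / 2 : ℝ) (1 / 2) := by constructor <;> norm_num
  have hc : ∀ y, |(fun y : Fin n → ℝ => |∑ i, x i * y i| ^ q * (-(1 / 2) * ∑ i, v i * y i ^ 2)) y|
      ≤ (∑ i, x i ^ 2) ^ (q / 2) * (1 + ∑ i, y i ^ 2) ^ 2 := fun y => by
    refine le_trans ?_ (abs_mul_weighted_sq_sum_le hv0 hv1
      (abs_sum_mul_rpow_le_pow x · hq hq1) y)
    simp only [abs_mul]
    norm_num
    have : 0 ≤ |(|∑ i, x i * y i| ^ q)| * |∑ i, v i * y i ^ 2| := by positivity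
    linarith
  have h1 := hasDerivAt_integral_mul_exp hv0 hv1 (by fun_prop) hc h0
  have h2 := (((hasDerivAt_logGaussianMoment hv0 hv1 hx h0 q).exp).mul
    (hasDerivAt_logGaussianMoment'_zero hv0 hv1 hx q)).const_mul C
  have h := h1.unique (h2.congr_of_eventuallyEq (by
    filter_upwards [isOpen_Ioo.mem_nhds h0] with e he
    exact integral_mul_weighted_sq_sum_mul_exp hv0 hv1 hx he hq hq1 hC))
  rw [exp_logGaussianMoment_zero hx] at h
  have h3 : ∀ y : Fin n → ℝ, |∑ i, x i * y i| ^ q * (∑ i, v i * y i ^ 2) ^ 2 *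
        Real.exp (-(1 / 2 * ∑ i, y i ^ 2)) = 4 * (|∑ i, x i * y i| ^ q *
        (-(1 / 2) * ∑ i, v i * y i ^ 2) * (-(1 / 2) * ∑ i, v i * y i ^ 2) *
        Real.exp (-(1 / 2 * ∑ i, (1 + 0 * v i) * y i ^ 2))) := fun y => by
    simp only [zero_mul, add_zero, one_mul]; ring
  simp only [h3]
  rw [integral_const_mul, h, logGaussianMoment']
  simp only [zero_mul, add_zero, div_one, one_pow, mul_comm (x _ ^ 2)]
  ring

end

/-! ### Axial coordinates and the explicit densities -/

/-- The square of the last coordinate. -/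
def axialSq {n : ℕ} (y : Fin n → ℝ) : ℝ :=
  ∑ i : Fin n, (if (i : ℕ) + 1 = n then 1 else 0) * y i ^ 2

/-- The sum of the squares of all coordinates but the last. -/
def transverseSq {n : ℕ} (y : Fin n → ℝ) : ℝ :=
  ∑ i : Fin n, (if (i : ℕ) + 1 = n then 0 else 1) * y i ^ 2

@[fun_prop]
theorem continuous_axialSq {n : ℕ} : Continuous (axialSq (n := n)) := by
  unfold axialSq; fun_prop

@[fun_prop]
theorem measurable_axialSq {n : ℕ} : Measurable (axialSq (n := n)) := continuous_axialSq.measurable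

theorem axialSq_nonneg {n : ℕ} (y : Fin n → ℝ) : 0 ≤ axialSq y :=
  Finset.sum_nonneg fun i _ => by split_ifs <;> positivity

theorem transverseSq_nonneg {n : ℕ} (y : Fin n → ℝ) : 0 ≤ transverseSq y :=
  Finset.sum_nonneg fun i _ => by split_ifs <;> positivity

theorem transverseSq_add_axialSq {n : ℕ} (y : Fin n → ℝ) :
    transverseSq y + axialSq y = ∑ i, y i ^ 2 := by
  rw [transverseSq, axialSq, ← Finset.sum_add_distrib]
  exact Finset.sum_congr rfl fun i _ => by split_ifs <;> ring

theorem axialSq_le {n : ℕ} (y : Fin n → ℝ) : axialSq y ≤ ∑ i, y i ^ 2 := by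
  linarith [transverseSq_add_axialSq y, transverseSq_nonneg y]

theorem sum_axial_weights {n : ℕ} (hn : 0 < n) :
    ∑ i : Fin n, (if (i : ℕ) + 1 = n then (1 : ℝ) else 0) = 1 := by
  rw [Finset.sum_eq_single (⟨n - 1, by omega⟩ : Fin n)]
  · simp; omega
  · intro i _ hi
    rw [if_neg]
    intro h
    exact hi (Fin.ext (by simp; omega))
  · simp

theorem sum_transverse_weights {n : ℕ} (hn : 0 < n) :
    ∑ i : Fin n, (if (i : ℕ) + 1 = n then (0 : ℝ) else 1) = n - 1 := by
  have h : ∑ i : Fin n, (if (i : ℕ) + 1 = n then (0 : ℝ) else 1) +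
      ∑ i : Fin n, (if (i : ℕ) + 1 = n then (1 : ℝ) else 0) = n := by
    rw [← Finset.sum_add_distrib]
    rw [Finset.sum_congr rfl (g := fun _ => (1 : ℝ)) fun i _ => by split_ifs <;> norm_num]
    simp
  rw [sum_axial_weights hn] at h
  linarith

theorem spoiledNorm_eq {n : ℕ} (lam : ℝ) (x : Fin n → ℝ) :
    spoiledNorm n lam x = √(∑ i, x i ^ 2) *
      (1 + lam * (1 - 3 * (axialSq x / ∑ i, x i ^ 2))) ^ 2 := by
  unfold spoiledNorm
  have h : ∑ i : Fin n, (if (i : ℕ) + 1 = n then -2 else 1) * x i ^ 2 =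
      (∑ i, x i ^ 2) - 3 * axialSq x := by
    rw [axialSq, Finset.mul_sum, ← Finset.sum_sub_distrib]
    exact Finset.sum_congr rfl fun i _ => by split_ifs <;> ring
  rw [h]
  by_cases hR : ∑ i, x i ^ 2 = 0
  · simp [hR]
  · rw [sub_div, div_self hR, mul_div_assoc]

theorem axialSq_div_mem {n : ℕ} (x : Fin n → ℝ) : axialSq x / ∑ i, x i ^ 2 ∈ Set.Icc (0 : ℝ) 1 :=
  ⟨div_nonneg (axialSq_nonneg x) (by positivity),
    div_le_one_of_le₀ (axialSq_le x) (by positivity)⟩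

theorem spoiledNorm_of_sum_sq_eq_zero {n : ℕ} {lam : ℝ} {x : Fin n → ℝ} (hx : ∑ i, x i ^ 2 = 0) :
    spoiledNorm n lam x = 0 := by
  simp [spoiledNorm, hx]

theorem integrable_abs_sum_mul_rpow_mul {n : ℕ} (x : Fin n → ℝ) {q : ℝ} (hq : 0 < q) (hq1 : q ≤ 1)
    {h : (Fin n → ℝ) → ℝ} (hm : Measurable h) {c : ℝ} {m : ℕ}
    (hc : ∀ y, |h y| ≤ c * (1 + ∑ i, y i ^ 2) ^ m) :
    Integrable fun y => |∑ i, x i * y i| ^ q * h y * Real.exp (-(1 / 2 * ∑ i, y i ^ 2)) := by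
  refine integrable_mul_exp_neg_of_le_pow (c := (∑ i, x i ^ 2) ^ (q / 2) * c) (1 + m)
    (by norm_num) (by fun_prop) fun y => ?_
  rw [abs_mul, pow_add]
  calc _ ≤ ((∑ i, x i ^ 2) ^ (q / 2) * (1 + ∑ i, y i ^ 2) ^ 1) *
        (c * (1 + ∑ i, y i ^ 2) ^ m) := by
        gcongr
        · exact abs_sum_mul_rpow_le_pow x y hq hq1
        · exact hc y
    _ = _ := by ring

/-- The value at the pole of the density which represents `N_λ ^ (1/2)`. -/
def halfDensityPole (n : ℕ) (lam : ℝ) : ℝ := (1 - (6 * n - 4) * lam) / (n + 1 / 2)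

/-- At `q = 1/2` the weights `|y|²` and `yₙ²` produce the factors `n + 1/2` and `1 + t/2`; their
combination must equal `1 + λ - 3λt`, which fixes both coefficients. -/
theorem integral_halfDensity {n : ℕ} (hn : 0 < n) :
    ∃ C : ℝ, 0 < C ∧ ∀ lam : ℝ, 0 ≤ lam → lam ≤ 1 / 2 → ∀ x : Fin n → ℝ,
      ∫ y : Fin n → ℝ, |∑ i, x i * y i| ^ (1 / 2 : ℝ) *
        ((∑ i, y i ^ 2) ^ 1 * (halfDensityPole n lam +
          6 * lam * (1 - axialSq y / ∑ i, y i ^ 2))) *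
        Real.exp (-(1 / 2 * ∑ i, y i ^ 2)) = C * spoiledNorm n lam x ^ (1 / 2 : ℝ) := by
  obtain ⟨C, hC0, hC⟩ := exists_integral_abs_sum_mul_rpow hn (q := 1 / 2) (by norm_num)
    (by norm_num)
  refine ⟨C, hC0, fun lam hl0 hl1 x => ?_⟩
  rcases (show 0 ≤ ∑ i, x i ^ 2 by positivity).eq_or_lt with hx | hx
  · have h0 : ∀ i, x i = 0 := fun i => by
      have := (Finset.sum_eq_zero_iff_of_nonneg (fun i _ => sq_nonneg (x i))).1 hx.symm i
        (Finset.mem_univ i)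
      exact pow_eq_zero_iff (two_ne_zero) |>.1 this
    rw [spoiledNorm_of_sum_sq_eq_zero hx.symm]
    simp [h0]
  have h1 := integral_mul_weighted_sq_sum (v := fun _ : Fin n => (1 : ℝ)) (by simp) (by simp) hx
    (q := 1 / 2) (by norm_num) (by norm_num) hC
  have h2 := integral_mul_weighted_sq_sum
    (v := fun i : Fin n => if (i : ℕ) + 1 = n then (1 : ℝ) else 0)
    (fun i => by split_ifs <;> norm_num) (fun i => by split_ifs <;> norm_num) hx
    (q := 1 / 2) (by norm_num) (by norm_num) hC
  rw [sum_axial_weights hn] at h2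
  have hsplit : ∀ y : Fin n → ℝ, |∑ i, x i * y i| ^ (1 / 2 : ℝ) *
        ((∑ i, y i ^ 2) ^ 1 * (halfDensityPole n lam +
          6 * lam * (1 - axialSq y / ∑ i, y i ^ 2))) * Real.exp (-(1 / 2 * ∑ i, y i ^ 2)) =
      (halfDensityPole n lam + 6 * lam) * (|∑ i, x i * y i| ^ (1 / 2 : ℝ) *
        (∑ i, 1 * y i ^ 2) * Real.exp (-(1 / 2 * ∑ i, y i ^ 2))) +
      (-6 * lam) * (|∑ i, x i * y i| ^ (1 / 2 : ℝ) * axialSq y *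
        Real.exp (-(1 / 2 * ∑ i, y i ^ 2))) := fun y => by
    have : axialSq y / (∑ i, y i ^ 2) * (∑ i, y i ^ 2) = axialSq y := by
      refine div_mul_cancel_of_imp fun h => le_antisymm (h ▸ axialSq_le y) (axialSq_nonneg y)
    simp only [one_mul, pow_one]
    linear_combination (-6 * lam) * (|∑ i, x i * y i| ^ (1 / 2 : ℝ) *
      Real.exp (-(1 / 2 * ∑ i, y i ^ 2))) * this
  have hi1 := integrable_abs_sum_mul_rpow_mul x (q := 1 / 2) (by norm_num) (by norm_num)
    (h := fun y => ∑ i, 1 * y i ^ 2) (by fun_prop) (c := 1) (m := 1) (fun y => by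
      have : 0 ≤ ∑ i, y i ^ 2 := by positivity
      simp only [one_mul, pow_one]
      rw [abs_of_nonneg this]; linarith)
  have hi2 := integrable_abs_sum_mul_rpow_mul x (q := 1 / 2) (by norm_num) (by norm_num)
    (h := axialSq) (by fun_prop) (c := 1) (m := 1) (fun y => by
      rw [abs_of_nonneg (axialSq_nonneg y)]; linarith [axialSq_le y])
  simp only [hsplit]
  rw [integral_add (hi1.const_mul _) (hi2.const_mul _), integral_const_mul, integral_const_mul, h1]
  change _ + -6 * lam * (∫ y : Fin n → ℝ, |∑ i, x i * y i| ^ (1 / 2 : ℝ) * (∑ i : Fin n,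
    (if (i : ℕ) + 1 = n then 1 else 0) * y i ^ 2) * Real.exp (-(1 / 2 * ∑ i, y i ^ 2))) = _
  rw [h2]
  change _ + -6 * lam * (_ * (1 + 1 / 2 * (axialSq x / _))) = _
  obtain ⟨ht0, ht1⟩ := axialSq_div_mem x
  -- The bound `λ ≤ 1/2` gives `1 + λ(1 - 3t) ≥ 0`, so the root of its square is itself.
  rw [spoiledNorm_eq, Real.mul_rpow (Real.sqrt_nonneg _) (by positivity), Real.sqrt_eq_rpow,
    ← Real.rpow_mul hx.le, ← Real.sqrt_eq_rpow (_ ^ 2), Real.sqrt_sq (by nlinarith)]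
  have hn' : (n : ℝ) + 1 / 2 ≠ 0 := by positivity
  have hn2 : 2 * (n : ℝ) + 1 ≠ 0 := by positivity
  simp only [one_mul, div_self hx.ne', Finset.sum_const, Finset.card_univ, Fintype.card_fin,
    nsmul_eq_mul, mul_one]
  generalize axialSq x / ∑ i, x i ^ 2 = t
  have he : (1 / 2 : ℝ) / 2 = 1 / 2 * (1 / 2) := by norm_num
  rw [he]
  have hp : halfDensityPole n lam * (n + 1 / 2) = 1 - (6 * n - 4) * lam := div_mul_cancel₀ _ hn'
  linear_combination C * (∑ i, x i ^ 2) ^ (1 / 2 * (1 / 2) : ℝ) * hp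

/-- As a function of `τ = yₙ² / |y|²`, the density which represents `N_λ`. -/
def oneDensity (n : ℕ) (lam t : ℝ) : ℝ :=
  (1 + 8 * lam - 20 * lam ^ 2) / ((n + 1) * (n + 3)) +
    (48 * lam ^ 2 - 6 * lam) / (n + 3) * t + -9 * lam ^ 2 * t ^ 2

theorem integral_oneDensity {n : ℕ} (hn : 0 < n) :
    ∃ C : ℝ, 0 < C ∧ ∀ (lam : ℝ) (x : Fin n → ℝ),
      ∫ y : Fin n → ℝ, |∑ i, x i * y i| ^ (1 : ℝ) *
        ((∑ i, y i ^ 2) ^ 2 * oneDensity n lam (axialSq y / ∑ i, y i ^ 2)) *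
        Real.exp (-(1 / 2 * ∑ i, y i ^ 2)) = C * spoiledNorm n lam x ^ (1 : ℝ) := by
  obtain ⟨C, hC0, hC⟩ := exists_integral_abs_sum_mul_rpow hn (q := 1) (by norm_num) le_rfl
  refine ⟨C, hC0, fun lam x => ?_⟩
  rcases (show 0 ≤ ∑ i, x i ^ 2 by positivity).eq_or_lt with hx | hx
  · have h0 : ∀ i, x i = 0 := fun i => by
      have := (Finset.sum_eq_zero_iff_of_nonneg (fun i _ => sq_nonneg (x i))).1 hx.symm i
        (Finset.mem_univ i)
      exact pow_eq_zero_iff (two_ne_zero) |>.1 this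
    rw [spoiledNorm_of_sum_sq_eq_zero hx.symm]
    simp [h0]
  have h1 := integral_mul_weighted_sq_sum_sq (v := fun _ : Fin n => (1 : ℝ)) (by simp) (by simp) hx
    (q := 1) (by norm_num) le_rfl hC
  have h2 := integral_mul_weighted_sq_sum_sq
    (v := fun i : Fin n => if (i : ℕ) + 1 = n then (1 : ℝ) else 0)
    (fun i => by split_ifs <;> norm_num) (fun i => by split_ifs <;> norm_num) hx
    (q := 1) (by norm_num) le_rfl hC
  have h3 := integral_mul_weighted_sq_sum_sq
    (v := fun i : Fin n => if (i : ℕ) + 1 = n then (0 : ℝ) else 1)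
    (fun i => by split_ifs <;> norm_num) (fun i => by split_ifs <;> norm_num) hx
    (q := 1) (by norm_num) le_rfl hC
  simp only [ite_pow, one_pow, zero_pow two_ne_zero] at h2 h3
  simp only [one_pow] at h1
  rw [sum_axial_weights hn] at h2
  rw [sum_transverse_weights hn] at h3
  have hax : ∀ y : Fin n → ℝ,
      ∑ i : Fin n, (if (i : ℕ) + 1 = n then (1 : ℝ) else 0) * y i ^ 2 = axialSq y := fun _ => rfl
  have htr : ∀ y : Fin n → ℝ,
      ∑ i : Fin n, (if (i : ℕ) + 1 = n then (0 : ℝ) else 1) * y i ^ 2 = transverseSq y :=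
    fun _ => rfl
  simp only [hax] at h2
  simp only [htr] at h3
  have hX : transverseSq x / (∑ i, x i ^ 2) = 1 - axialSq x / ∑ i, x i ^ 2 := by
    rw [← transverseSq_add_axialSq] at hx ⊢
    field_simp; ring
  rw [hX] at h3
  set a := (1 + 8 * lam - 20 * lam ^ 2) / (((n : ℝ) + 1) * (n + 3)) with ha
  set b := (48 * lam ^ 2 - 6 * lam) / ((n : ℝ) + 3) with hb
  -- Polarisation: only squares of forms have known integrals, so with `R = A + T` (total, axial,
  -- transverse) the mixed term is written `R A = (R² + A² - T²) / 2`.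
  have hsplit : ∀ y : Fin n → ℝ, |∑ i, x i * y i| ^ (1 : ℝ) *
        ((∑ i, y i ^ 2) ^ 2 * oneDensity n lam (axialSq y / ∑ i, y i ^ 2)) *
          Real.exp (-(1 / 2 * ∑ i, y i ^ 2)) =
      (a + b / 2) * (|∑ i, x i * y i| ^ (1 : ℝ) *
        (∑ i, 1 * y i ^ 2) ^ 2 * Real.exp (-(1 / 2 * ∑ i, y i ^ 2))) +
      ((-9 * lam ^ 2 + b / 2) * (|∑ i, x i * y i| ^ (1 : ℝ) * axialSq y ^ 2 *
        Real.exp (-(1 / 2 * ∑ i, y i ^ 2))) +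
      (-b / 2) * (|∑ i, x i * y i| ^ (1 : ℝ) * transverseSq y ^ 2 *
        Real.exp (-(1 / 2 * ∑ i, y i ^ 2)))) := fun y => by
    have h4 : axialSq y / (∑ i, y i ^ 2) * (∑ i, y i ^ 2) = axialSq y := by
      refine div_mul_cancel_of_imp fun h => le_antisymm (h ▸ axialSq_le y) (axialSq_nonneg y)
    rw [show transverseSq y = (∑ i, y i ^ 2) - axialSq y by
      linarith [transverseSq_add_axialSq y], oneDensity, ← ha, ← hb]
    simp only [one_mul]
    generalize axialSq y / (∑ i, y i ^ 2) = t at *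
    rw [← h4]
    ring
  have hgrow : ∀ f : (Fin n → ℝ) → ℝ, (∀ y, 0 ≤ f y) → (∀ y, f y ≤ ∑ i, y i ^ 2) →
      ∀ y, |f y ^ 2| ≤ 1 * (1 + ∑ i, y i ^ 2) ^ 2 := fun f h0 h1 y => by
    rw [abs_of_nonneg (by positivity), one_mul]
    exact pow_le_pow_left₀ (h0 y) (by linarith [h1 y]) 2
  have hi1 := integrable_abs_sum_mul_rpow_mul x (q := 1) (by norm_num) le_rfl
    (h := fun y => (∑ i, 1 * y i ^ 2) ^ 2) (by fun_prop)
    (hgrow _ (fun y => by positivity) fun y => by simp)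
  have hi2 := integrable_abs_sum_mul_rpow_mul x (q := 1) (by norm_num) le_rfl
    (h := fun y => axialSq y ^ 2) (by fun_prop) (hgrow _ axialSq_nonneg axialSq_le)
  have hi3 := integrable_abs_sum_mul_rpow_mul x (q := 1) (by norm_num) le_rfl
    (h := fun y => transverseSq y ^ 2) (by unfold transverseSq; fun_prop)
    (hgrow _ transverseSq_nonneg fun y => by
      linarith [transverseSq_add_axialSq y, axialSq_nonneg y])
  simp only [hsplit]
  rw [integral_add (hi1.const_mul _) ((hi2.const_mul _).fun_add (hi3.const_mul _)),
    integral_add (hi2.const_mul _) (hi3.const_mul _), integral_const_mul,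
    integral_const_mul, integral_const_mul, h1, h2, h3, Real.rpow_one, spoiledNorm_eq,
    Real.sqrt_eq_rpow]
  simp only [one_mul, div_self hx.ne', Finset.sum_const, Finset.card_univ, Fintype.card_fin,
    nsmul_eq_mul, mul_one]
  generalize axialSq x / ∑ i, x i ^ 2 = t
  have hn1 : (n : ℝ) + 1 ≠ 0 := by positivity
  have hn3 : (n : ℝ) + 3 ≠ 0 := by positivity
  have hb' : b * (n + 3) = 48 * lam ^ 2 - 6 * lam := div_mul_cancel₀ _ hn3
  have ha' : a * ((n + 1) * (n + 3)) = 1 + 8 * lam - 20 * lam ^ 2 :=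
    div_mul_cancel₀ _ (mul_ne_zero hn1 hn3)
  linear_combination C * (∑ i, x i ^ 2) ^ (1 / 2 : ℝ) * (ha' + (1 + t) * hb')

theorem isometricToSubspaceOfLp_of_density {n : ℕ} {lam : ℝ} {p : ℝ≥0∞} (hp0 : p ≠ 0)
    (hp1 : p ≤ 1) {h : (Fin n → ℝ) → ℝ} (hm : Measurable h) (h0 : ∀ y, 0 ≤ h y) {c : ℝ} {m : ℕ}
    (hc : ∀ y, |h y| ≤ c * (1 + ∑ i, y i ^ 2) ^ m) {C : ℝ} (hC : 0 < C)
    (hrep : ∀ x : Fin n → ℝ, ∫ y, |∑ i, x i * y i| ^ p.toReal * h y *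
      Real.exp (-(1 / 2 * ∑ i, y i ^ 2)) = C * spoiledNorm n lam x ^ p.toReal) :
    IsometricToSubspaceOfLp p (SpoiledSpace n lam) := by
  have hp : p ≠ ∞ := (hp1.trans_lt ENNReal.one_lt_top).ne
  have hq : 0 < p.toReal := ENNReal.toReal_pos hp0 hp
  have hq1 : p.toReal ≤ 1 := by
    simpa using (ENNReal.toReal_le_toReal hp ENNReal.one_ne_top).2 hp1
  let d : (Fin n → ℝ) → ℝ := fun y => C⁻¹ * (h y * Real.exp (-(1 / 2 * ∑ i, y i ^ 2)))
  have hd0 : ∀ y, 0 ≤ d y := fun y => by have := h0 y; positivity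
  have hdm : Measurable fun y => ENNReal.ofReal (d y) := by fun_prop
  have hdint : Integrable d :=
    (integrable_mul_exp_neg_of_le_pow m (by norm_num) hm hc).const_mul _
  have hfin : IsFiniteMeasure (volume.withDensity fun y => ENNReal.ofReal (d y)) :=
    isFiniteMeasure_withDensity_ofReal hdint.2
  have hmul : ∀ x y : Fin n → ℝ, d y * |∑ i, x i * y i| ^ p.toReal =
      C⁻¹ * (|∑ i, x i * y i| ^ p.toReal * h y * Real.exp (-(1 / 2 * ∑ i, y i ^ 2))) :=
    fun x y => by simp only [d]; ring
  refine isometricToSubspaceOfLp_of_measure hp0 hp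
    (volume.withDensity fun y => ENNReal.ofReal (d y)) (fun x => ?_) fun x => ?_
  · rw [integrable_withDensity_iff_integrable_smul' hdm (by simp)]
    simp only [ENNReal.toReal_ofReal (hd0 _), smul_eq_mul, hmul]
    exact (integrable_abs_sum_mul_rpow_mul x hq hq1 hm hc).const_mul _
  · rw [integral_withDensity_eq_integral_toReal_smul hdm (by simp)]
    simp only [ENNReal.toReal_ofReal (hd0 _), smul_eq_mul, hmul]
    rw [integral_const_mul, hrep x, inv_mul_cancel_left₀ hC.ne']

/-! ### Uniqueness of the moments of `τ` and positivity at the pole -/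

section Fubini

variable {Ω : Type*} [MeasurableSpace Ω] {ν : Measure Ω}

/-- Averaging over Gaussian `x` before integrating in `ω` turns `|⟨x, ξ⟩| ^ q` into a power of a
quadratic form in `ξ`. The function `g` may change sign, so this covers signed densities. -/
theorem integral_integral_abs_sum_mul_rpow [SFinite ν] {n : ℕ} {q C : ℝ} (hq : 0 < q)
    (hq1 : q ≤ 1)
    (hC : ∀ x : Fin n → ℝ,
      ∫ y : Fin n → ℝ, |∑ i, x i * y i| ^ q * Real.exp (-(1 / 2 * ∑ i, y i ^ 2)) =
        C * (∑ i, x i ^ 2) ^ (q / 2))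
    {ξ : Ω → Fin n → ℝ} (hξ : Measurable ξ) {g : Ω → ℝ} (hg : Measurable g)
    (hint : Integrable (fun ω => g ω * (∑ i, ξ ω i ^ 2) ^ (q / 2)) ν)
    {w : Fin n → ℝ} {b : ℝ} (hb : 0 < b) (hw : ∀ i, b ≤ w i) :
    ∫ x : Fin n → ℝ, (∫ ω, |∑ i, x i * ξ ω i| ^ q * g ω ∂ν) *
        Real.exp (-(1 / 2 * ∑ i, w i * x i ^ 2)) =
      C * (∏ i, (√(w i))⁻¹) * ∫ ω, g ω * (∑ i, ξ ω i ^ 2 / w i) ^ (q / 2) ∂ν := by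
  have h1 : Integrable fun x : Fin n → ℝ =>
      (∑ i, x i ^ 2) ^ (q / 2) * Real.exp (-(b / 2 * ∑ i, x i ^ 2)) := by
    refine integrable_mul_exp_neg_of_le_pow (c := 1) 1 (by positivity) (by fun_prop) fun x => ?_
    rw [abs_of_nonneg (by positivity), one_mul, pow_one]
    exact rpow_le_one_add (by positivity) (by positivity) (by linarith)
  have hprod : Integrable (Function.uncurry fun (x : Fin n → ℝ) ω =>
      |∑ i, x i * ξ ω i| ^ q * g ω * Real.exp (-(1 / 2 * ∑ i, w i * x i ^ 2)))
      (volume.prod ν) := by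
    refine (h1.mul_prod hint).mono ?_ (Filter.Eventually.of_forall fun ⟨x, ω⟩ => ?_)
    · apply Measurable.aestronglyMeasurable
      have : Measurable fun z : (Fin n → ℝ) × Ω => ξ z.2 := hξ.comp measurable_snd
      have : ∀ i, Measurable fun z : (Fin n → ℝ) × Ω => ξ z.2 i :=
        fun i => (measurable_pi_apply i).comp this
      unfold Function.uncurry
      fun_prop
    · simp only [Function.uncurry, Real.norm_eq_abs, abs_mul, Real.abs_exp]
      rw [abs_of_nonneg (by positivity : 0 ≤ |∑ i, x i * ξ ω i| ^ q),
        abs_of_nonneg (by positivity : 0 ≤ (∑ i, x i ^ 2) ^ (q / 2)),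
        abs_of_nonneg (by positivity : 0 ≤ (∑ i, ξ ω i ^ 2) ^ (q / 2))]
      calc |∑ i, x i * ξ ω i| ^ q * |g ω| * Real.exp (-(1 / 2 * ∑ i, w i * x i ^ 2))
          ≤ ((∑ i, x i ^ 2) ^ (q / 2) * (∑ i, ξ ω i ^ 2) ^ (q / 2)) * |g ω| *
            Real.exp (-(b / 2 * ∑ i, x i ^ 2)) := by
            have h2 : b / 2 * ∑ i, x i ^ 2 ≤ 1 / 2 * ∑ i, w i * x i ^ 2 := by
              rw [Finset.mul_sum, Finset.mul_sum]
              refine Finset.sum_le_sum fun i _ => ?_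
              nlinarith [hw i, sq_nonneg (x i)]
            refine mul_le_mul ?_ (Real.exp_le_exp.2 (neg_le_neg h2)) (Real.exp_nonneg _)
              (by positivity)
            gcongr
            exact abs_sum_mul_rpow_le x (ξ ω) hq.le
        _ = _ := by ring
  calc _ = ∫ x : Fin n → ℝ, ∫ ω, |∑ i, x i * ξ ω i| ^ q * g ω *
        Real.exp (-(1 / 2 * ∑ i, w i * x i ^ 2)) ∂ν := by simp only [integral_mul_const]
    _ = ∫ ω, (∫ x : Fin n → ℝ, |∑ i, x i * ξ ω i| ^ q * g ω *
        Real.exp (-(1 / 2 * ∑ i, w i * x i ^ 2))) ∂ν := integral_integral_swap hprod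
    _ = ∫ ω, C * (∏ i, (√(w i))⁻¹) * (g ω * (∑ i, ξ ω i ^ 2 / w i) ^ (q / 2)) ∂ν := by
        refine integral_congr_ae (Filter.Eventually.of_forall fun ω => ?_)
        have h3 := integral_abs_sum_mul_rpow_weighted hC w (fun i => hb.trans_le (hw i)) (ξ ω)
        have h4 : ∀ x : Fin n → ℝ, |∑ i, x i * ξ ω i| ^ q * g ω *
            Real.exp (-(1 / 2 * ∑ i, w i * x i ^ 2)) = g ω * (|∑ i, ξ ω i * x i| ^ q *
            Real.exp (-(1 / 2 * ∑ i, w i * x i ^ 2))) := fun x => by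
          simp only [mul_comm (x _) (ξ ω _)]; ring
        simp only [h4]
        rw [integral_const_mul, h3]
        ring
    _ = _ := integral_const_mul _ _

theorem rpow_le_of_mem_Icc {r a : ℝ} (hr : r ∈ Set.Icc (1 / 2 : ℝ) (3 / 2)) :
    r ^ a ≤ (1 / 2) ^ a + (3 / 2) ^ a := by
  have h1 : (0 : ℝ) < (1 / 2) ^ a := by positivity
  have h2 : (0 : ℝ) < (3 / 2) ^ a := by positivity
  rcases le_total 0 a with ha | ha
  · linarith [Real.rpow_le_rpow (by linarith [hr.1]) hr.2 ha]
  · linarith [Real.rpow_le_rpow_of_nonpos (by norm_num) hr.1 ha]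

theorem one_add_mul_mem_Icc {s t : ℝ} (hs : s ∈ Set.Ioo (-1 / 2 : ℝ) (1 / 2))
    (ht : t ∈ Set.Icc (0 : ℝ) 1) : 1 + s * t ∈ Set.Icc (1 / 2 : ℝ) (3 / 2) := by
  constructor <;> nlinarith [hs.1, hs.2, ht.1, ht.2]

theorem integrable_mul_one_add_mul_rpow {G τ : Ω → ℝ} (hG : Integrable G ν) (hτm : Measurable τ)
    (hτ : ∀ ω, τ ω ∈ Set.Icc (0 : ℝ) 1) (a : ℝ) {s : ℝ} (hs : s ∈ Set.Ioo (-1 / 2 : ℝ) (1 / 2)) :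
    Integrable (fun ω => G ω * (1 + s * τ ω) ^ a) ν := by
  refine hG.mul_bdd (c := (1 / 2) ^ a + (3 / 2) ^ a) ?_ (Filter.Eventually.of_forall fun ω => ?_)
  · apply Measurable.aestronglyMeasurable; fun_prop
  · have h := one_add_mul_mem_Icc hs (hτ ω)
    rw [Real.norm_eq_abs, abs_of_nonneg (Real.rpow_nonneg (by linarith [h.1]) _)]
    exact rpow_le_of_mem_Icc h

theorem hasDerivAt_integral_mul_one_add_mul_rpow {G τ : Ω → ℝ} (hG : Integrable G ν)
    (hτm : Measurable τ) (hτ : ∀ ω, τ ω ∈ Set.Icc (0 : ℝ) 1) (a : ℝ) {s : ℝ}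
    (hs : s ∈ Set.Ioo (-1 / 2 : ℝ) (1 / 2)) :
    HasDerivAt (fun s => ∫ ω, G ω * (1 + s * τ ω) ^ a ∂ν)
      (a * ∫ ω, G ω * τ ω * (1 + s * τ ω) ^ (a - 1) ∂ν) s := by
  have hGτ : Integrable (fun ω => G ω * τ ω) ν :=
    hG.mul_bdd (c := 1) hτm.aestronglyMeasurable (Filter.Eventually.of_forall fun ω => by
      rw [Real.norm_eq_abs, abs_of_nonneg (hτ ω).1]; exact (hτ ω).2)
  rw [← integral_const_mul]
  refine (hasDerivAt_integral_of_dominated_loc_of_deriv_le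
    (F := fun s ω => G ω * (1 + s * τ ω) ^ a)
    (F' := fun s ω => a * (G ω * τ ω * (1 + s * τ ω) ^ (a - 1)))
    (bound := fun ω => |a| * (|G ω * τ ω| * ((1 / 2) ^ (a - 1) + (3 / 2) ^ (a - 1))))
    (isOpen_Ioo.mem_nhds hs) ?_ ?_ ?_ ?_ ?_ ?_).2
  · filter_upwards [isOpen_Ioo.mem_nhds hs] with s' hs'
    exact (integrable_mul_one_add_mul_rpow hG hτm hτ a hs').aestronglyMeasurable
  · exact integrable_mul_one_add_mul_rpow hG hτm hτ a hs
  · exact ((integrable_mul_one_add_mul_rpow hGτ hτm hτ (a - 1) hs).const_mul a).aestronglyMeasurable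
  · refine Filter.Eventually.of_forall fun ω s' hs' => ?_
    have h := one_add_mul_mem_Icc hs' (hτ ω)
    rw [Real.norm_eq_abs, abs_mul, abs_mul _ (_ ^ _),
      abs_of_nonneg (Real.rpow_nonneg (by linarith [h.1] : 0 ≤ 1 + s' * τ ω) _)]
    gcongr
    exact rpow_le_of_mem_Icc h
  · exact (hGτ.abs.mul_const _).const_mul _
  · refine Filter.Eventually.of_forall fun ω s' hs' => ?_
    have h := one_add_mul_mem_Icc hs' (hτ ω)
    have h1 : HasDerivAt (fun s => 1 + s * τ ω) (τ ω) s' := by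
      simpa using ((hasDerivAt_id s').mul_const (τ ω)).const_add 1
    refine ((h1.rpow_const (p := a) (Or.inl (by linarith [h.1]))).const_mul (G ω)).congr_deriv ?_
    ring

/-- Differentiating `k` times in `s` yields the factor `a (a - 1) ⋯ (a - k + 1)`, which can be
cancelled because `a` is not a natural number; then put `s = 0`. -/
theorem integral_mul_pow_eq_of_integral_rpow_eq {Ω' : Type*} [MeasurableSpace Ω']
    {ν' : Measure Ω'} {G τ : Ω → ℝ} {G' τ' : Ω' → ℝ}
    (hG : Integrable G ν) (hτm : Measurable τ) (hτ : ∀ ω, τ ω ∈ Set.Icc (0 : ℝ) 1)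
    (hG' : Integrable G' ν') (hτm' : Measurable τ') (hτ' : ∀ ω, τ' ω ∈ Set.Icc (0 : ℝ) 1)
    {a : ℝ} (ha : ∀ k : ℕ, a ≠ k)
    (h : ∀ s ∈ Set.Ioo (-1 / 2 : ℝ) (1 / 2), ∫ ω, G ω * (1 + s * τ ω) ^ a ∂ν =
      ∫ ω, G' ω * (1 + s * τ' ω) ^ a ∂ν') (k : ℕ) :
    ∫ ω, G ω * τ ω ^ k ∂ν = ∫ ω, G' ω * τ' ω ^ k ∂ν' := by
  have hk : ∀ k : ℕ, Integrable (fun ω => G ω * τ ω ^ k) ν := fun k =>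
    hG.mul_bdd (c := 1) (hτm.pow_const k).aestronglyMeasurable
      (Filter.Eventually.of_forall fun ω => by
        rw [Real.norm_eq_abs, abs_of_nonneg (pow_nonneg (hτ ω).1 k)]
        exact pow_le_one₀ (hτ ω).1 (hτ ω).2)
  have hk' : ∀ k : ℕ, Integrable (fun ω => G' ω * τ' ω ^ k) ν' := fun k =>
    hG'.mul_bdd (c := 1) (hτm'.pow_const k).aestronglyMeasurable
      (Filter.Eventually.of_forall fun ω => by
        rw [Real.norm_eq_abs, abs_of_nonneg (pow_nonneg (hτ' ω).1 k)]
        exact pow_le_one₀ (hτ' ω).1 (hτ' ω).2)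
  have key : ∀ k : ℕ, ∀ s ∈ Set.Ioo (-1 / 2 : ℝ) (1 / 2),
      ∫ ω, G ω * τ ω ^ k * (1 + s * τ ω) ^ (a - k) ∂ν =
        ∫ ω, G' ω * τ' ω ^ k * (1 + s * τ' ω) ^ (a - k) ∂ν' := by
    intro k
    induction k with
    | zero => simpa using h
    | succ k ih =>
      intro s hs
      have h1 := hasDerivAt_integral_mul_one_add_mul_rpow (hk k) hτm hτ (a - k) hs
      have h2 := hasDerivAt_integral_mul_one_add_mul_rpow (hk' k) hτm' hτ' (a - k) hs
      have h3 := h1.unique (h2.congr_of_eventuallyEq (by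
        filter_upwards [isOpen_Ioo.mem_nhds hs] with s' hs' using ih s' hs'))
      have h4 := mul_left_cancel₀ (sub_ne_zero.2 (ha k)) h3
      simpa only [pow_succ, Nat.cast_succ, ← sub_sub, mul_assoc] using h4
  simpa using key k 0 (by constructor <;> norm_num)

/-- If `f 1 < 0`, then `f` is below a negative constant near `1`, where `ρ` has mass, and `τ ^ k`
makes that region outweigh the rest for large `k`. -/
theorem nonneg_at_one_of_integral_mul_pow_nonneg {ρ τ : Ω → ℝ} (hρ : Integrable ρ ν)
    (hρ0 : ∀ ω, 0 ≤ ρ ω) (hτm : Measurable τ) (hτ : ∀ ω, τ ω ∈ Set.Icc (0 : ℝ) 1)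
    (hpos : ∀ δ < 1, 0 < ∫ ω in {ω | δ < τ ω}, ρ ω ∂ν) {f : ℝ → ℝ} (hf : Continuous f)
    (h : ∀ k : ℕ, 0 ≤ ∫ ω, ρ ω * f (τ ω) * τ ω ^ k ∂ν) : 0 ≤ f 1 := by
  by_contra! hf1
  obtain ⟨M, hM⟩ := isCompact_Icc.exists_bound_of_continuousOn (s := Set.Icc (0 : ℝ) 1)
    hf.continuousOn
  have hM0 : 0 ≤ M := (norm_nonneg _).trans (hM 0 (by simp))
  set ε : ℝ := -f 1 / 2 with hε
  have hε0 : 0 < ε := by linarith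
  obtain ⟨η, hη, hηf⟩ : ∃ η > 0, ∀ t, |t - 1| < η → f t < -ε := by
    have h1 : ∀ᶠ t in nhds (1 : ℝ), f t < -ε := hf.continuousAt.eventually_lt_const (by linarith)
    obtain ⟨η, hη, h2⟩ := Metric.eventually_nhds_iff.1 h1
    exact ⟨η, hη, fun t ht => h2 (by rwa [Real.dist_eq])⟩
  set δ : ℝ := max (1 - η / 2) (1 / 2) with hδ
  have hδ1 : δ < 1 := max_lt (by linarith) (by norm_num)
  have hδ0 : 0 < δ := lt_of_lt_of_le (by norm_num) (le_max_right _ _)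
  have hδf : ∀ t ∈ Set.Icc (0 : ℝ) 1, δ < t → f t < -ε := fun t ht htδ => by
    refine hηf t ?_
    have : 1 - η / 2 < t := (le_max_left _ _).trans_lt htδ
    rw [abs_lt]; constructor <;> linarith [ht.2]
  -- Two thresholds: positive contributions come only from `τ ≤ δ` and are `O(δ ^ k)`, while the
  -- part `τ > δ'` contributes at most `-ε J δ' ^ k`. The ratio `(δ/δ') ^ k` tends to zero.
  set δ' : ℝ := (1 + δ) / 2 with hδ'
  have hδδ' : δ < δ' := by linarith
  have hδ'0 : 0 < δ' := by linarith
  set J := ∫ ω in {ω | δ' < τ ω}, ρ ω ∂ν with hJ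
  have hJ0 : 0 < J := hpos δ' (by linarith)
  have hms : MeasurableSet {ω | δ' < τ ω} := measurableSet_lt measurable_const hτm
  have hbound : ∀ k : ℕ, ε * J ≤ M * (∫ ω, ρ ω ∂ν) * (δ / δ') ^ k := by
    intro k
    have h1 : ∫ ω, ρ ω * f (τ ω) * τ ω ^ k ∂ν ≤
        ∫ ω, (M * δ ^ k) * ρ ω - (ε * δ' ^ k) * {ω | δ' < τ ω}.indicator ρ ω ∂ν := by
      refine integral_mono_ae ?_ ((hρ.const_mul _).sub ((hρ.indicator hms).const_mul _))
        (Filter.Eventually.of_forall fun ω => ?_)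
      · simp only [mul_assoc]
        refine hρ.mul_bdd (c := M) (by apply Measurable.aestronglyMeasurable; fun_prop)
          (Filter.Eventually.of_forall fun ω => ?_)
        rw [norm_mul, norm_pow, Real.norm_of_nonneg (hτ ω).1]
        exact (mul_le_of_le_one_right (norm_nonneg _) (pow_le_one₀ (hτ ω).1 (hτ ω).2)).trans
          (hM _ (hτ ω))
      · have hr := hρ0 ω
        have ht0 := (hτ ω).1
        have hfM : f (τ ω) ≤ M := (le_abs_self _).trans (hM _ (hτ ω))
        have hMδ : 0 ≤ M * δ ^ k := by positivity
        by_cases h1 : δ' < τ ω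
        · simp only [Set.indicator, Set.mem_ofPred_eq, h1, if_true]
          have h2 : f (τ ω) * τ ω ^ k ≤ -ε * δ' ^ k := by
            have h3 := hδf _ (hτ ω) (hδδ'.trans h1)
            have h4 : δ' ^ k ≤ τ ω ^ k := pow_le_pow_left₀ hδ'0.le h1.le k
            nlinarith [pow_pos hδ'0 k]
          nlinarith
        · simp only [Set.indicator, Set.mem_ofPred_eq, h1, if_false, mul_zero, sub_zero]
          have h2 : f (τ ω) * τ ω ^ k ≤ M * δ ^ k := by
            by_cases h3 : δ < τ ω
            · have h4 := hδf _ (hτ ω) h3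
              nlinarith [pow_nonneg ht0 k]
            · have h4 : τ ω ^ k ≤ δ ^ k := pow_le_pow_left₀ ht0 (not_lt.1 h3) k
              nlinarith [pow_nonneg ht0 k]
          nlinarith
    rw [integral_sub (hρ.const_mul _) ((hρ.indicator hms).const_mul _), integral_const_mul,
      integral_const_mul, integral_indicator hms, ← hJ] at h1
    have h2 := (h k).trans h1
    rw [div_pow, mul_div_assoc', le_div_iff₀ (by positivity)]
    linarith
  have hlim : Filter.Tendsto (fun k : ℕ => M * (∫ ω, ρ ω ∂ν) * (δ / δ') ^ k) Filter.atTop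
      (nhds (M * (∫ ω, ρ ω ∂ν) * 0)) :=
    (tendsto_pow_atTop_nhds_zero_of_lt_one (by positivity)
      ((div_lt_one hδ'0).2 hδδ')).const_mul _
  have := ge_of_tendsto' hlim hbound
  nlinarith

end Fubini

theorem rpow_sum_le_sum_rpow {ι : Type*} (s : Finset ι) (f : ι → ℝ) (hf : ∀ i, 0 ≤ f i) {a : ℝ}
    (ha : 0 < a) (ha1 : a ≤ 1) : (∑ i ∈ s, f i) ^ a ≤ ∑ i ∈ s, f i ^ a := by
  classical
  induction s using Finset.induction_on with
  | empty => simp [ha.ne']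
  | insert i s hi ih =>
    rw [Finset.sum_insert hi, Finset.sum_insert hi]
    exact (Real.rpow_add_le_add_rpow (hf i) (Finset.sum_nonneg fun j _ => hf j) ha.le ha1).trans
      (by gcongr)

theorem axialSq_div_mul_cancel {n : ℕ} (y : Fin n → ℝ) :
    axialSq y / (∑ i, y i ^ 2) * (∑ i, y i ^ 2) = axialSq y :=
  div_mul_cancel_of_imp fun h => le_antisymm (h ▸ axialSq_le y) (axialSq_nonneg y)

/-- With weight `(1 + s)⁻¹` on the last axis, `∑ ξᵢ² / wᵢ` equals `|ξ|² (1 + sτ)`. -/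
theorem integral_axial_tilt {Ω : Type*} [MeasurableSpace Ω] {ν : Measure Ω} [SFinite ν] {n : ℕ}
    {q C : ℝ} (hq : 0 < q) (hq1 : q ≤ 1)
    (hC : ∀ x : Fin n → ℝ,
      ∫ y : Fin n → ℝ, |∑ i, x i * y i| ^ q * Real.exp (-(1 / 2 * ∑ i, y i ^ 2)) =
        C * (∑ i, x i ^ 2) ^ (q / 2))
    {ξ : Ω → Fin n → ℝ} (hξ : Measurable ξ) {g : Ω → ℝ} (hg : Measurable g)
    (hint : Integrable (fun ω => g ω * (∑ i, ξ ω i ^ 2) ^ (q / 2)) ν)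
    {s : ℝ} (hs : s ∈ Set.Ioo (-1 / 2 : ℝ) (1 / 2)) :
    ∫ x : Fin n → ℝ, (∫ ω, |∑ i, x i * ξ ω i| ^ q * g ω ∂ν) *
        Real.exp (-(1 / 2 * ∑ i : Fin n, (if (i : ℕ) + 1 = n then (1 + s)⁻¹ else 1) * x i ^ 2)) =
      C * (∏ i : Fin n, (√(if (i : ℕ) + 1 = n then (1 + s)⁻¹ else 1))⁻¹) *
        ∫ ω, (g ω * (∑ i, ξ ω i ^ 2) ^ (q / 2)) *
          (1 + s * (axialSq (ξ ω) / ∑ i, ξ ω i ^ 2)) ^ (q / 2) ∂ν := by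
  have hs1 : 0 < 1 + s := by linarith [hs.1]
  rw [integral_integral_abs_sum_mul_rpow hq hq1 hC hξ hg hint (b := 1 / 2) (by norm_num)]
  · congr 1
    refine integral_congr_ae (Filter.Eventually.of_forall fun ω => ?_)
    have h1 : ∑ i : Fin n, ξ ω i ^ 2 / (if (i : ℕ) + 1 = n then (1 + s)⁻¹ else 1) =
        (∑ i, ξ ω i ^ 2) * (1 + s * (axialSq (ξ ω) / ∑ i, ξ ω i ^ 2)) := by
      have h2 : ∑ i : Fin n, ξ ω i ^ 2 / (if (i : ℕ) + 1 = n then (1 + s)⁻¹ else 1) =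
          (∑ i, ξ ω i ^ 2) + s * axialSq (ξ ω) := by
        rw [axialSq, Finset.mul_sum, ← Finset.sum_add_distrib]
        refine Finset.sum_congr rfl fun i _ => ?_
        split_ifs
        · rw [div_inv_eq_mul]; ring
        · simp
      rw [h2]
      linear_combination (-s) * axialSq_div_mul_cancel (ξ ω)
    have h3 := (one_add_mul_mem_Icc hs (axialSq_div_mem (ξ ω))).1
    simp only [h1]
    rw [Real.mul_rpow (by positivity) (by linarith), mul_assoc]
  · intro i
    split_ifs
    · rw [le_inv_comm₀ (by norm_num) hs1]; linarith [hs.2]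
    · norm_num

theorem measurable_axialSq_div {n : ℕ} :
    Measurable fun y : Fin n → ℝ => axialSq y / ∑ i, y i ^ 2 := by
  fun_prop

theorem integral_axialSq_div_pos {n : ℕ} (hn : 0 < n) {ρ : (Fin n → ℝ) → ℝ} (hρ : Integrable ρ)
    (hρ0 : ∀ y, 0 ≤ ρ y) (hρ1 : ∀ y, 0 < ∑ i, y i ^ 2 → 0 < ρ y) {δ : ℝ} (hδ : δ < 1) :
    0 < ∫ y in {y : Fin n → ℝ | δ < axialSq y / ∑ i, y i ^ 2}, ρ y := by
  have hms : MeasurableSet {y : Fin n → ℝ | δ < axialSq y / ∑ i, y i ^ 2} :=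
    measurableSet_lt measurable_const measurable_axialSq_div
  rw [setIntegral_pos_iff_support_of_nonneg_ae (Filter.Eventually.of_forall hρ0) hρ.integrableOn]
  have hopen : IsOpen {y : Fin n → ℝ | 0 < ∑ i, y i ^ 2 ∧ δ * (∑ i, y i ^ 2) < axialSq y} := by
    have h1 : IsOpen {y : Fin n → ℝ | 0 < ∑ i, y i ^ 2} :=
      isOpen_lt continuous_const (by fun_prop)
    have h2 : IsOpen {y : Fin n → ℝ | δ * (∑ i, y i ^ 2) < axialSq y} :=
      isOpen_lt (by fun_prop) (by fun_prop)
    exact h1.inter h2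
  refine (hopen.measure_pos volume ?_).trans_le (measure_mono ?_)
  · have h1 : ∑ i : Fin n, (if (i : ℕ) + 1 = n then (1 : ℝ) else 0) ^ 2 = 1 := by
      simpa only [ite_pow, one_pow, zero_pow two_ne_zero] using sum_axial_weights hn
    refine ⟨fun i => if (i : ℕ) + 1 = n then 1 else 0, ?_, ?_⟩
    · rw [h1]; exact one_pos
    · rw [h1, mul_one, axialSq]
      have : ∀ i : Fin n, (if (i : ℕ) + 1 = n then (1 : ℝ) else 0) *
          (if (i : ℕ) + 1 = n then (1 : ℝ) else 0) ^ 2 =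
          (if (i : ℕ) + 1 = n then (1 : ℝ) else 0) := fun i => by split_ifs <;> norm_num
      simp only [this, sum_axial_weights hn, hδ]
  · rintro y ⟨h0, h1⟩
    exact ⟨(hρ1 y h0).ne', (lt_div_iff₀ h0).2 h1⟩

/-- The random vector `ξ` (with weight 1) and the signed density `g` both represent `N_λ ^ q`, so
their `τ`-moments weighted by `|·| ^ q` agree; those of `ξ` are visibly nonnegative. -/
theorem IsometricToSubspaceOfLp.density_nonneg_at_pole {n : ℕ} (hn : 0 < n) {lam : ℝ} {p : ℝ≥0∞}
    (hp0 : p ≠ 0) (hp1 : p ≤ 1) {f : ℝ → ℝ} (hf : Continuous f) (m : ℕ) {C : ℝ} (hC : 0 < C)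
    (hrep : ∀ x : Fin n → ℝ, ∫ y, |∑ i, x i * y i| ^ p.toReal *
      ((∑ i, y i ^ 2) ^ m * f (axialSq y / ∑ i, y i ^ 2)) *
      Real.exp (-(1 / 2 * ∑ i, y i ^ 2)) = C * spoiledNorm n lam x ^ p.toReal)
    (h : IsometricToSubspaceOfLp p (SpoiledSpace n lam)) : 0 ≤ f 1 := by
  have hp : p ≠ ∞ := (hp1.trans_lt ENNReal.one_lt_top).ne
  have hq : 0 < p.toReal := ENNReal.toReal_pos hp0 hp
  have hq1 : p.toReal ≤ 1 := by
    simpa using (ENNReal.toReal_le_toReal hp ENNReal.one_ne_top).2 hp1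
  set q := p.toReal
  obtain ⟨ξ, hξ, hξint, hξrep⟩ := h.exists_representation hp0 hp
  obtain ⟨C₀, hC₀, hC₀rep⟩ := exists_integral_abs_sum_mul_rpow hn hq hq1
  obtain ⟨M, hM⟩ := isCompact_Icc.exists_bound_of_continuousOn (s := Set.Icc (0 : ℝ) 1)
    hf.continuousOn
  have hM0 : 0 ≤ M := (norm_nonneg _).trans (hM 0 (by simp))
  let ρ : (Fin n → ℝ) → ℝ := fun y =>
    (∑ i, y i ^ 2) ^ m * (∑ i, y i ^ 2) ^ (q / 2) * Real.exp (-(1 / 2 * ∑ i, y i ^ 2))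
  have hρint : Integrable ρ := by
    refine integrable_mul_exp_neg_of_le_pow (c := 1) (m + 1) (by norm_num) (by fun_prop) fun y => ?_
    rw [abs_of_nonneg (by positivity), one_mul, pow_succ]
    have h1 : 0 ≤ ∑ i, y i ^ 2 := by positivity
    gcongr
    · linarith
    · exact rpow_le_one_add h1 (by positivity) (by linarith)
  have hρ0 : ∀ y, 0 ≤ ρ y := fun y => by positivity
  have hτ := fun y : Fin n → ℝ => axialSq_div_mem y
  let g : (Fin n → ℝ) → ℝ := fun y =>
    C⁻¹ * ((∑ i, y i ^ 2) ^ m * f (axialSq y / ∑ i, y i ^ 2) *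
      Real.exp (-(1 / 2 * ∑ i, y i ^ 2)))
  have hgm : Measurable g := by
    have : Measurable fun y : Fin n → ℝ => f (axialSq y / ∑ i, y i ^ 2) :=
      hf.measurable.comp measurable_axialSq_div
    fun_prop
  have hgρ : ∀ y, g y * (∑ i, y i ^ 2) ^ (q / 2) =
      C⁻¹ * (ρ y * f (axialSq y / ∑ i, y i ^ 2)) := fun y => by simp only [g, ρ]; ring
  have hgint : Integrable fun y => g y * (∑ i, y i ^ 2) ^ (q / 2) := by
    simp only [hgρ]
    refine (hρint.mul_bdd (c := M) ?_ (Filter.Eventually.of_forall fun y => hM _ (hτ y))).const_mul _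
    exact (hf.measurable.comp measurable_axialSq_div).aestronglyMeasurable
  have hξint' : Integrable (fun t => (1 : ℝ) * (∑ i, ξ t i ^ 2) ^ (q / 2))
      (volume.restrict (Set.Icc (0 : ℝ) 1)) := by
    refine (integrable_finsetSum Finset.univ fun i _ => hξint i).mono' ?_
      (Filter.Eventually.of_forall fun t => ?_)
    · have : ∀ i, Measurable fun t => ξ t i := fun i => (measurable_pi_apply i).comp hξ
      apply Measurable.aestronglyMeasurable; fun_prop
    · rw [one_mul, Real.norm_eq_abs, abs_of_nonneg (by positivity)]
      refine (rpow_sum_le_sum_rpow Finset.univ (fun i => ξ t i ^ 2) (fun i => sq_nonneg _)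
        (by positivity) (by linarith)).trans_eq (Finset.sum_congr rfl fun i _ => ?_)
      rw [← sq_abs, ← Real.rpow_natCast, ← Real.rpow_mul (abs_nonneg _)]
      congr 1
      push_cast; ring
  -- The exponent `q/2` lies strictly between 0 and 1, hence is no natural number.
  have hmom := integral_mul_pow_eq_of_integral_rpow_eq hξint'
    (measurable_axialSq_div.comp hξ) (fun t => hτ (ξ t)) hgint measurable_axialSq_div hτ
    (a := q / 2) (fun k hk => by
      rcases Nat.eq_zero_or_pos k with rfl | hk0
      · simp at hk; linarith
      · have : (1 : ℝ) ≤ k := by exact_mod_cast hk0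
        linarith) (fun s hs => by
      have h1 := integral_axial_tilt hq hq1 hC₀rep hξ measurable_const hξint' hs
      have h2 := integral_axial_tilt hq hq1 hC₀rep measurable_id hgm hgint hs
      have h3 : ∀ x : Fin n → ℝ, ∫ t, |∑ i, x i * ξ t i| ^ q * (1 : ℝ)
          ∂(volume.restrict (Set.Icc (0 : ℝ) 1)) = ∫ y : Fin n → ℝ, |∑ i, x i * id y i| ^ q * g y := by
        intro x
        simp only [mul_one, id]
        rw [hξrep x]
        have h4 : ∀ y : Fin n → ℝ, |∑ i, x i * y i| ^ q * g y = C⁻¹ * (|∑ i, x i * y i| ^ q *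
            ((∑ i, y i ^ 2) ^ m * f (axialSq y / ∑ i, y i ^ 2)) *
            Real.exp (-(1 / 2 * ∑ i, y i ^ 2))) := fun y => by simp only [g]; ring
        simp only [h4]
        rw [integral_const_mul, hrep x, inv_mul_cancel_left₀ hC.ne']
      simp only [h3] at h1
      rw [h1] at h2
      refine mul_left_cancel₀ (mul_ne_zero hC₀.ne' (Finset.prod_ne_zero_iff.2 fun i _ => ?_)) h2
      have hs1 : 0 < 1 + s := by linarith [hs.1]
      split_ifs <;> positivity)
  refine nonneg_at_one_of_integral_mul_pow_nonneg hρint hρ0 measurable_axialSq_div hτ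
    (fun δ hδ => integral_axialSq_div_pos hn hρint hρ0 (fun y hy => by positivity) hδ) hf fun k => ?_
  have h1 := hmom k
  simp only [hgρ, mul_assoc] at h1
  rw [integral_const_mul C⁻¹] at h1
  simp only [mul_assoc]
  have h2 : 0 ≤ C⁻¹ * ∫ y, ρ y * (f (axialSq y / ∑ i, y i ^ 2) *
      (axialSq y / ∑ i, y i ^ 2) ^ k) := by
    rw [← h1]
    refine integral_nonneg fun t => ?_
    have := (hτ (ξ t)).1
    simp only [Function.comp_apply]
    positivity
  exact nonneg_of_mul_nonneg_right h2 (by positivity)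

/-! ### The triangle inequality through the planar profile -/

/-- The profile of `N_λ` in the half-plane of pairs `(|x'|, |xₙ|)`, with `a = 1 + λ` and
`b = 1 - 2 λ`. -/
def planarNorm (a b r z : ℝ) : ℝ := (a * r ^ 2 + b * z ^ 2) ^ 2 / √(r ^ 2 + z ^ 2) ^ 3

theorem planarNorm_swap (a b r z : ℝ) : planarNorm a b r z = planarNorm b a z r := by
  unfold planarNorm; rw [add_comm (a * r ^ 2), add_comm (r ^ 2)]

theorem planarNorm_zero_right (a b : ℝ) {r : ℝ} (hr : 0 ≤ r) : planarNorm a b r 0 = a ^ 2 * r := by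
  unfold planarNorm
  rcases hr.eq_or_lt with rfl | hr0
  · simp
  · simp only [ne_eq, OfNat.ofNat_ne_zero, not_false_eq_true, zero_pow, mul_zero, add_zero,
      Real.sqrt_sq hr]
    field_simp

theorem planarNorm_mul (a b : ℝ) {c : ℝ} (hc : 0 < c) (r z : ℝ) :
    planarNorm a b (c * r) (c * z) = c * planarNorm a b r z := by
  unfold planarNorm
  have h : √((c * r) ^ 2 + (c * z) ^ 2) = c * √(r ^ 2 + z ^ 2) := by
    rw [show (c * r) ^ 2 + (c * z) ^ 2 = c ^ 2 * (r ^ 2 + z ^ 2) by ring,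
      Real.sqrt_mul (by positivity), Real.sqrt_sq hc.le]
  rw [h, mul_pow c (√_), show (a * (c * r) ^ 2 + b * (c * z) ^ 2) ^ 2 =
    c ^ 3 * (c * (a * r ^ 2 + b * z ^ 2) ^ 2) by ring, mul_div_mul_left _ _ (by positivity),
    mul_div_assoc]

theorem planarNorm_eq_mul (a b r : ℝ) {z : ℝ} (hz : 0 < z) :
    planarNorm a b r z = z * planarNorm a b (r / z) 1 := by
  rw [← planarNorm_mul a b hz, mul_div_cancel₀ _ hz.ne', mul_one]

theorem hasDerivAt_div_sqrt_pow {f : ℝ → ℝ} {f' u : ℝ} (hf : HasDerivAt f f' u) (j : ℕ) :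
    HasDerivAt (fun u => f u / √(u ^ 2 + 1) ^ j)
      ((f' * (u ^ 2 + 1) - j * u * f u) / √(u ^ 2 + 1) ^ (j + 2)) u := by
  have h0 : 0 < u ^ 2 + 1 := by positivity
  have hs : HasDerivAt (fun u : ℝ => √(u ^ 2 + 1)) (u / √(u ^ 2 + 1)) u := by
    refine (((hasDerivAt_pow 2 u).add_const 1).sqrt h0.ne').congr_deriv ?_
    field_simp
    push_cast; ring
  have hs0 : 0 < √(u ^ 2 + 1) := Real.sqrt_pos.2 h0
  refine (hf.div (hs.fun_pow j) (pow_pos hs0 j).ne').congr_deriv ?_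
  have hsq : u ^ 2 + 1 = √(u ^ 2 + 1) ^ 2 := (Real.sq_sqrt h0.le).symm
  generalize √(u ^ 2 + 1) = s at *
  rw [hsq]
  rcases j with _ | j
  · field_simp; simp; ring
  · field_simp
    simp only [Nat.add_sub_cancel]
    ring

theorem hasDerivAt_planarNorm (a b u : ℝ) :
    HasDerivAt (fun u => planarNorm a b u 1)
      (u * (a * u ^ 2 + b) * (a * u ^ 2 + (4 * a - 3 * b)) / √(u ^ 2 + 1) ^ 5) u := by
  have h : HasDerivAt (fun u : ℝ => (a * u ^ 2 + b) ^ 2) (4 * a * u * (a * u ^ 2 + b)) u := by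
    refine (((((hasDerivAt_id u).pow 2).const_mul a).add_const b).pow 2).congr_deriv ?_
    simp only [id]; push_cast; simp; ring
  have h2 := hasDerivAt_div_sqrt_pow h 3
  simp only [planarNorm, one_pow, mul_one]
  refine h2.congr_deriv ?_
  congr 1
  push_cast; ring

theorem hasDerivAt_deriv_planarNorm (a b u : ℝ) :
    HasDerivAt (fun u => u * (a * u ^ 2 + b) * (a * u ^ 2 + (4 * a - 3 * b)) / √(u ^ 2 + 1) ^ 5)
      ((a * (4 * b - 3 * a) * (u ^ 2) ^ 2 + (12 * a ^ 2 - 22 * a * b + 12 * b ^ 2) * u ^ 2 +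
        b * (4 * a - 3 * b)) / √(u ^ 2 + 1) ^ 7) u := by
  have h : HasDerivAt (fun u : ℝ => u * (a * u ^ 2 + b) * (a * u ^ 2 + (4 * a - 3 * b)))
      (5 * a ^ 2 * u ^ 4 + 3 * a * (4 * a - 2 * b) * u ^ 2 + b * (4 * a - 3 * b)) u := by
    have h1 := (((hasDerivAt_id u).pow 2).const_mul a).add_const b
    have h2 := (((hasDerivAt_id u).pow 2).const_mul a).add_const (4 * a - 3 * b)
    refine (((hasDerivAt_id u).mul h1).mul h2).congr_deriv ?_
    simp; ring
  refine (hasDerivAt_div_sqrt_pow h 5).congr_deriv ?_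
  congr 1
  push_cast; ring

section

variable {a b : ℝ} (hb : 0 < b) (hab : 0 ≤ 4 * a - 3 * b)

-- Homogeneity reduces to `z = 1`, where every factor of the derivative is nonnegative for `u ≥ 0`
-- because `4a ≥ 3b`.
include hb hab in
theorem planarNorm_mono_left {r r' z : ℝ} (hr : 0 ≤ r) (hrr' : r ≤ r') (hz : 0 ≤ z) :
    planarNorm a b r z ≤ planarNorm a b r' z := by
  have ha : 0 < a := by linarith
  rcases hz.eq_or_lt with rfl | hz
  · rw [planarNorm_zero_right _ _ hr, planarNorm_zero_right _ _ (hr.trans hrr')]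
    gcongr
  · rw [planarNorm_eq_mul _ _ _ hz, planarNorm_eq_mul a b r' hz]
    have hmono : MonotoneOn (fun u => planarNorm a b u 1) (Set.Ici 0) := by
      refine monotoneOn_of_hasDerivWithinAt_nonneg (convex_Ici 0)
        (fun u _ => (hasDerivAt_planarNorm a b u).continuousAt.continuousWithinAt)
        (fun u _ => (hasDerivAt_planarNorm a b u).hasDerivWithinAt) fun u hu => ?_
      rw [interior_Ici] at hu
      have hu0 : 0 < u := hu
      have : 0 ≤ a * u ^ 2 + (4 * a - 3 * b) := by positivity
      positivity
    refine mul_le_mul_of_nonneg_left (hmono ?_ ?_ ?_) hz.le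
    · exact div_nonneg hr hz.le
    · exact div_nonneg (hr.trans hrr') hz.le
    · gcongr

variable (hba : 0 ≤ 4 * b - 3 * a)

include hb hab hba

theorem planarNorm_mono {r r' z z' : ℝ} (hr : 0 ≤ r) (hrr' : r ≤ r') (hz : 0 ≤ z)
    (hzz' : z ≤ z') : planarNorm a b r z ≤ planarNorm a b r' z' := by
  have ha : 0 < a := by linarith
  refine (planarNorm_mono_left hb hab hr hrr' hz).trans ?_
  rw [planarNorm_swap a b, planarNorm_swap a b]
  exact planarNorm_mono_left ha hba hz hzz' (hr.trans hrr')

theorem convexOn_planarNorm : ConvexOn ℝ Set.univ fun u => planarNorm a b u 1 := by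
  have ha : 0 < a := by linarith
  have hd : deriv (fun u => planarNorm a b u 1) = fun u =>
      u * (a * u ^ 2 + b) * (a * u ^ 2 + (4 * a - 3 * b)) / √(u ^ 2 + 1) ^ 5 :=
    funext fun u => (hasDerivAt_planarNorm a b u).deriv
  refine convexOn_univ_of_deriv2_nonneg
    (fun u => (hasDerivAt_planarNorm a b u).differentiableAt) ?_ fun u => ?_
  · rw [hd]
    exact fun u => (hasDerivAt_deriv_planarNorm a b u).differentiableAt
  · simp only [Function.iterate_succ, Function.iterate_zero, Function.comp_apply, id]
    rw [hd, (hasDerivAt_deriv_planarNorm a b u).deriv]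
    -- This is `12 (a - b)² + 2ab`; the other two coefficients of the second derivative are
    -- nonnegative by `hab` and `hba`.
    have : 0 ≤ 12 * a ^ 2 - 22 * a * b + 12 * b ^ 2 := by
      nlinarith [sq_nonneg (a - b), mul_pos ha hb]
    positivity

/-- The perspective `z * φ(r / z)` of a convex function `φ` is subadditive. -/
theorem planarNorm_add_le_of_pos {r₁ z₁ r₂ z₂ : ℝ} (hz₁ : 0 < z₁) (hz₂ : 0 < z₂) :
    planarNorm a b (r₁ + r₂) (z₁ + z₂) ≤ planarNorm a b r₁ z₁ + planarNorm a b r₂ z₂ := by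
  have hz : 0 < z₁ + z₂ := by positivity
  have h := (convexOn_planarNorm hb hab hba).2 (Set.mem_univ (r₁ / z₁)) (Set.mem_univ (r₂ / z₂))
    (div_pos hz₁ hz).le (div_pos hz₂ hz).le (by field_simp)
  simp only [smul_eq_mul] at h
  rw [planarNorm_eq_mul _ _ _ hz, planarNorm_eq_mul a b r₁ hz₁, planarNorm_eq_mul a b r₂ hz₂]
  have h1 : z₁ / (z₁ + z₂) * (r₁ / z₁) + z₂ / (z₁ + z₂) * (r₂ / z₂) = (r₁ + r₂) / (z₁ + z₂) := by
    field_simp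
  rw [h1] at h
  refine (mul_le_mul_of_nonneg_left h hz.le).trans_eq ?_
  field_simp

-- Serves to extend subadditivity to `z = 0`, where the perspective formula is unavailable.
omit hb hab hba in
theorem tendsto_planarNorm_add {r z : ℝ} (hr : 0 ≤ r) (hz : 0 ≤ z) :
    Filter.Tendsto (fun ε => planarNorm a b r (z + ε)) (nhdsWithin 0 (Set.Ioi 0))
      (nhds (planarNorm a b r z)) := by
  by_cases h : r ^ 2 + z ^ 2 = 0
  · have hr0 : r = 0 := by nlinarith
    have hz0 : z = 0 := by nlinarith
    subst hr0 hz0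
    rw [planarNorm_zero_right a b le_rfl]
    have h1 : Filter.Tendsto (fun ε : ℝ => b ^ 2 * ε) (nhdsWithin 0 (Set.Ioi 0))
        (nhds (b ^ 2 * 0)) :=
      ((continuous_const.mul continuous_id).tendsto 0).mono_left nhdsWithin_le_nhds
    rw [mul_zero] at h1 ⊢
    refine h1.congr' ?_
    filter_upwards [self_mem_nhdsWithin] with ε hε
    rw [zero_add, planarNorm_swap, planarNorm_zero_right _ _ (le_of_lt hε)]
  · have hc : ContinuousAt (fun ε => planarNorm a b r (z + ε)) 0 := by
      unfold planarNorm
      refine ContinuousAt.div (by fun_prop) (by fun_prop) ?_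
      have : 0 < r ^ 2 + (z + 0) ^ 2 := by
        rw [add_zero]; exact lt_of_le_of_ne (by positivity) (Ne.symm h)
      positivity
    have := hc.tendsto.mono_left (nhdsWithin_le_nhds (s := Set.Ioi 0))
    simpa using this

theorem planarNorm_add_le {r₁ z₁ r₂ z₂ : ℝ} (hr₁ : 0 ≤ r₁) (hr₂ : 0 ≤ r₂) (hz₁ : 0 ≤ z₁)
    (hz₂ : 0 ≤ z₂) :
    planarNorm a b (r₁ + r₂) (z₁ + z₂) ≤ planarNorm a b r₁ z₁ + planarNorm a b r₂ z₂ := by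
  refine ge_of_tendsto ((tendsto_planarNorm_add hr₁ hz₁).add (tendsto_planarNorm_add hr₂ hz₂)) ?_
  filter_upwards [self_mem_nhdsWithin] with ε hε
  have hε0 : 0 < ε := hε
  refine le_trans ?_ (planarNorm_add_le_of_pos hb hab hba (by positivity) (by positivity))
  exact planarNorm_mono hb hab hba (by positivity) le_rfl (by positivity) (by linarith)

end

theorem spoiledNorm_eq_planarNorm {n : ℕ} (lam : ℝ) (x : Fin n → ℝ) :
    spoiledNorm n lam x =
      planarNorm (1 + lam) (1 - 2 * lam) (√(transverseSq x)) (√(axialSq x)) := by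
  rw [spoiledNorm_eq, planarNorm, Real.sq_sqrt (transverseSq_nonneg x),
    Real.sq_sqrt (axialSq_nonneg x), transverseSq_add_axialSq]
  have hT : transverseSq x = (∑ i, x i ^ 2) - axialSq x := by
    linarith [transverseSq_add_axialSq x]
  rcases (show 0 ≤ ∑ i, x i ^ 2 by positivity).eq_or_lt with hx | hx
  · simp [← hx]
  · have hs : 0 < √(∑ i, x i ^ 2) := Real.sqrt_pos.2 hx
    rw [hT]
    have hsq : ∑ i, x i ^ 2 = √(∑ i, x i ^ 2) ^ 2 := (Real.sq_sqrt hx.le).symm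
    generalize √(∑ i, x i ^ 2) = s at *
    rw [hsq]
    field_simp
    ring

theorem sqrt_sum_sq_add_le {n : ℕ} (x y : Fin n → ℝ) :
    √(∑ i, (x i + y i) ^ 2) ≤ √(∑ i, x i ^ 2) + √(∑ i, y i ^ 2) := by
  have := norm_add_le (WithLp.toLp 2 x : EuclideanSpace ℝ (Fin n)) (WithLp.toLp 2 y)
  simpa [EuclideanSpace.norm_eq] using this

theorem sqrt_axialSq_add_le {n : ℕ} (x y : Fin n → ℝ) :
    √(axialSq (x + y)) ≤ √(axialSq x) + √(axialSq y) := by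
  have h : ∀ x : Fin n → ℝ, axialSq x =
      ∑ i : Fin n, ((if (i : ℕ) + 1 = n then 1 else 0) * x i) ^ 2 := fun x =>
    Finset.sum_congr rfl fun i _ => by split_ifs <;> ring
  rw [h, h, h]
  simpa only [Pi.add_apply, mul_add] using
    sqrt_sum_sq_add_le (fun i : Fin n => (if (i : ℕ) + 1 = n then 1 else 0) * x i)
      (fun i : Fin n => (if (i : ℕ) + 1 = n then 1 else 0) * y i)

theorem sqrt_transverseSq_add_le {n : ℕ} (x y : Fin n → ℝ) :
    √(transverseSq (x + y)) ≤ √(transverseSq x) + √(transverseSq y) := by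
  have h : ∀ x : Fin n → ℝ, transverseSq x =
      ∑ i : Fin n, ((if (i : ℕ) + 1 = n then 0 else 1) * x i) ^ 2 := fun x =>
    Finset.sum_congr rfl fun i _ => by split_ifs <;> ring
  rw [h, h, h]
  simpa only [Pi.add_apply, mul_add] using
    sqrt_sum_sq_add_le (fun i : Fin n => (if (i : ℕ) + 1 = n then 0 else 1) * x i)
      (fun i : Fin n => (if (i : ℕ) + 1 = n then 0 else 1) * y i)

theorem spoiledNorm_smul {n : ℕ} (lam c : ℝ) (x : Fin n → ℝ) :
    spoiledNorm n lam (c • x) = |c| * spoiledNorm n lam x := by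
  have h1 : ∑ i, (c • x) i ^ 2 = c ^ 2 * ∑ i, x i ^ 2 := by
    simp [mul_pow, Finset.mul_sum]
  have h2 : axialSq (c • x) = c ^ 2 * axialSq x := by
    rw [axialSq, axialSq, Finset.mul_sum]
    refine Finset.sum_congr rfl fun i _ => ?_
    simp only [Pi.smul_apply, smul_eq_mul]; ring
  rw [spoiledNorm_eq, spoiledNorm_eq, h1, h2, Real.sqrt_mul (sq_nonneg c), Real.sqrt_sq_eq_abs]
  rcases eq_or_ne c 0 with rfl | hc
  · simp
  · rw [mul_div_mul_left _ _ (pow_ne_zero 2 hc), mul_assoc]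

theorem spoiledNorm_add_le {n : ℕ} {lam : ℝ} (hl0 : 0 ≤ lam) (hl1 : lam ≤ 1 / 11)
    (x y : Fin n → ℝ) :
    spoiledNorm n lam (x + y) ≤ spoiledNorm n lam x + spoiledNorm n lam y := by
  have hb : 0 < 1 - 2 * lam := by linarith
  have hab : 0 ≤ 4 * (1 + lam) - 3 * (1 - 2 * lam) := by linarith
  -- The expression is `1 - 11λ`: this is where the bound `1/11` comes from.
  have hba : 0 ≤ 4 * (1 - 2 * lam) - 3 * (1 + lam) := by linarith
  simp only [spoiledNorm_eq_planarNorm]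
  exact (planarNorm_mono hb hab hba (Real.sqrt_nonneg _) (sqrt_transverseSq_add_le _ _)
    (Real.sqrt_nonneg _) (sqrt_axialSq_add_le _ _)).trans
    (planarNorm_add_le hb hab hba (Real.sqrt_nonneg _) (Real.sqrt_nonneg _)
      (Real.sqrt_nonneg _) (Real.sqrt_nonneg _))

theorem spoiledNorm_eq_zero_iff {n : ℕ} {lam : ℝ} (hl0 : 0 ≤ lam) (hl1 : lam ≤ 1 / 11)
    (x : Fin n → ℝ) : spoiledNorm n lam x = 0 ↔ x = 0 := by
  constructor
  · intro h
    obtain ⟨ht0, ht1⟩ := axialSq_div_mem x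
    rw [spoiledNorm_eq] at h
    rcases mul_eq_zero.1 h with h | h
    · rw [Real.sqrt_eq_zero (by positivity),
        Finset.sum_eq_zero_iff_of_nonneg (fun i _ => sq_nonneg (x i))] at h
      exact funext fun i => pow_eq_zero_iff two_ne_zero |>.1 (h i (Finset.mem_univ i))
    · have := pow_eq_zero_iff two_ne_zero |>.1 h
      nlinarith
  · intro h
    exact spoiledNorm_of_sum_sq_eq_zero (by simp [h])

theorem normedSpaceCore_spoiledSpace (n : ℕ) {lam : ℝ} (hl0 : 0 ≤ lam) (hl1 : lam ≤ 1 / 11) :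
    NormedSpace.Core ℝ (SpoiledSpace n lam) where
  norm_nonneg := spoiledNorm_nonneg n lam
  norm_smul c x := spoiledNorm_smul lam c x
  norm_triangle x y := spoiledNorm_add_le hl0 hl1 x y
  norm_eq_zero_iff x := spoiledNorm_eq_zero_iff hl0 hl1 x

/-! ### The quadratic equation for `α_n` -/

theorem alphaBound_pos_and_root {n : ℕ} (hn : 3 ≤ n) :
    0 < alphaBound n ∧ (9 * (n : ℝ) ^ 2 - 12 * n - 1) * alphaBound n ^ 2 +
      (6 * n - 2) * alphaBound n - 1 = 0 := by
  have hn3 : (3 : ℝ) ≤ n := by exact_mod_cast hn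
  have hD : 0 < 9 * (n : ℝ) ^ 2 - 12 * n - 1 := by nlinarith
  have hS : 0 ≤ 18 * (n : ℝ) ^ 2 - 18 * n := by nlinarith
  have hs := Real.sq_sqrt hS
  constructor
  · refine div_pos ?_ hD
    -- The difference of the squares is the denominator `9n² - 12n - 1` itself.
    have : 3 * (n : ℝ) - 1 < √(18 * (n : ℝ) ^ 2 - 18 * n) := Real.lt_sqrt_of_sq_lt (by nlinarith)
    linarith
  · have h : alphaBound n * (9 * (n : ℝ) ^ 2 - 12 * n - 1) =
        √(18 * (n : ℝ) ^ 2 - 18 * n) - 3 * n + 1 := div_mul_cancel₀ _ hD.ne'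
    generalize √(18 * (n : ℝ) ^ 2 - 18 * n) = s at *
    refine mul_left_cancel₀ hD.ne' ?_
    linear_combination (alphaBound n * (9 * (n : ℝ) ^ 2 - 12 * n - 1) + s + 3 * n - 1) * h + hs

theorem le_alphaBound_iff {n : ℕ} (hn : 3 ≤ n) {lam : ℝ} (hl : 0 < lam) :
    lam ≤ alphaBound n ↔ (9 * (n : ℝ) ^ 2 - 12 * n - 1) * lam ^ 2 + (6 * n - 2) * lam - 1 ≤ 0 := by
  obtain ⟨h0, hroot⟩ := alphaBound_pos_and_root hn
  have hn3 : (3 : ℝ) ≤ n := by exact_mod_cast hn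
  have hD : 0 < 9 * (n : ℝ) ^ 2 - 12 * n - 1 := by nlinarith
  have hfac : (9 * (n : ℝ) ^ 2 - 12 * n - 1) * lam ^ 2 + (6 * n - 2) * lam - 1 =
      (lam - alphaBound n) *
        ((9 * (n : ℝ) ^ 2 - 12 * n - 1) * (lam + alphaBound n) + (6 * n - 2)) := by
    linear_combination hroot
  have hpos : 0 < (9 * (n : ℝ) ^ 2 - 12 * n - 1) * (lam + alphaBound n) + (6 * n - 2) := by
    have := mul_pos hD (add_pos hl h0)
    linarith
  rw [hfac, ← sub_nonpos]
  exact ⟨fun h => mul_nonpos_of_nonpos_of_nonneg h hpos.le,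
    fun h => nonpos_of_mul_nonpos_left h hpos⟩

/-- At `1 / (6n - 4)` the quadratic takes the positive value `(9n² - 9) / (6n - 4)²`. -/
theorem alphaBound_lt {n : ℕ} (hn : 3 ≤ n) : alphaBound n < 1 / (6 * (n : ℝ) - 4) := by
  have hn3 : (3 : ℝ) ≤ n := by exact_mod_cast hn
  have hc : 0 < 6 * (n : ℝ) - 4 := by linarith
  rw [← not_le, le_alphaBound_iff hn (by positivity), not_le]
  have h : (9 * (n : ℝ) ^ 2 - 12 * n - 1) * (1 / (6 * (n : ℝ) - 4)) ^ 2 +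
      (6 * n - 2) * (1 / (6 * (n : ℝ) - 4)) - 1 =
      (9 * (n : ℝ) ^ 2 - 9) / (6 * (n : ℝ) - 4) ^ 2 := by
    have hd : (6 * (n : ℝ) - 4) * (1 / (6 * (n : ℝ) - 4)) = 1 := mul_one_div_cancel hc.ne'
    rw [eq_div_iff (by positivity)]
    generalize 1 / (6 * (n : ℝ) - 4) = d at *
    linear_combination ((9 * (n : ℝ) ^ 2 - 12 * n - 1) * ((6 * n - 4) * d + 1) +
      (6 * n - 2) * (6 * n - 4)) * hd
  rw [h]
  exact div_pos (by nlinarith) (by positivity)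

/-! ### The embedding criterion for the two exponents -/

theorem abs_sum_sq_pow_mul_le {n : ℕ} {f : ℝ → ℝ} {M : ℝ} (m : ℕ)
    (hM : ∀ t ∈ Set.Icc (0 : ℝ) 1, |f t| ≤ M) (y : Fin n → ℝ) :
    |(∑ i, y i ^ 2) ^ m * f (axialSq y / ∑ i, y i ^ 2)| ≤ M * (1 + ∑ i, y i ^ 2) ^ m := by
  have h0 : 0 ≤ ∑ i, y i ^ 2 := by positivity
  have h1 := hM _ (axialSq_div_mem y)
  have hM0 := (abs_nonneg _).trans h1
  rw [abs_mul, abs_of_nonneg (by positivity), mul_comm]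
  gcongr
  linarith

theorem isometricToSubspaceOfLp_iff_of_zonal_density {n : ℕ} (hn : 0 < n) {lam : ℝ} {p : ℝ≥0∞}
    (hp0 : p ≠ 0) (hp1 : p ≤ 1) {f : ℝ → ℝ} (hf : Continuous f) (m : ℕ) {C : ℝ} (hC : 0 < C)
    (hrep : ∀ x : Fin n → ℝ, ∫ y, |∑ i, x i * y i| ^ p.toReal *
      ((∑ i, y i ^ 2) ^ m * f (axialSq y / ∑ i, y i ^ 2)) *
      Real.exp (-(1 / 2 * ∑ i, y i ^ 2)) = C * spoiledNorm n lam x ^ p.toReal)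
    (hmin : 0 ≤ f 1 → ∀ t ∈ Set.Icc (0 : ℝ) 1, 0 ≤ f t) :
    IsometricToSubspaceOfLp p (SpoiledSpace n lam) ↔ 0 ≤ f 1 := by
  refine ⟨fun h => h.density_nonneg_at_pole hn hp0 hp1 hf m hC hrep, fun h => ?_⟩
  obtain ⟨M, hM⟩ := isCompact_Icc.exists_bound_of_continuousOn (s := Set.Icc (0 : ℝ) 1)
    hf.continuousOn
  refine isometricToSubspaceOfLp_of_density hp0 hp1 ?_ (fun y => ?_)
    (abs_sum_sq_pow_mul_le m hM) hC hrep
  · have := hf.measurable.comp (measurable_axialSq_div (n := n))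
    exact Measurable.mul (by fun_prop) this
  · have := hmin h _ (axialSq_div_mem y)
    positivity

theorem isometricToSubspaceOfLp_half_iff {n : ℕ} (hn : 3 ≤ n) {lam : ℝ} (hl0 : 0 ≤ lam)
    (hl1 : lam ≤ 1 / 2) :
    IsometricToSubspaceOfLp (1 / 2) (SpoiledSpace n lam) ↔ lam ≤ 1 / (6 * (n : ℝ) - 4) := by
  have hn3 : (3 : ℝ) ≤ n := by exact_mod_cast hn
  obtain ⟨C, hC, hrep⟩ := integral_halfDensity (n := n) (by omega)
  have hhalf : (1 / 2 : ℝ≥0∞).toReal = 1 / 2 := by simp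
  rw [isometricToSubspaceOfLp_iff_of_zonal_density (by omega) (p := 1 / 2) (by simp) (by simp)
    (f := fun t => halfDensityPole n lam + 6 * lam * (1 - t)) (by fun_prop) 1 hC
    (by simpa only [hhalf] using hrep lam hl0 hl1)
    -- The density is affine and nonincreasing in `τ`, so its minimum is at the pole.
    (fun h t ht => by
      simp only [sub_self, mul_zero, add_zero] at h
      have := mul_nonneg hl0 (sub_nonneg.2 ht.2)
      linarith)]
  simp only [sub_self, mul_zero, add_zero, halfDensityPole]
  rw [le_div_iff₀ (by positivity : 0 < (n : ℝ) + 1 / 2), zero_mul, sub_nonneg,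
    le_div_iff₀ (by linarith), mul_comm]

theorem oneDensity_one {n : ℕ} (lam : ℝ) :
    oneDensity n lam 1 = -((9 * (n : ℝ) ^ 2 - 12 * n - 1) * lam ^ 2 + (6 * n - 2) * lam - 1) /
      ((n + 1) * (n + 3)) := by
  unfold oneDensity
  field_simp
  ring

theorem isometricToSubspaceOfLp_one_iff {n : ℕ} (hn : 3 ≤ n) {lam : ℝ} (hl0 : 0 < lam)
    (hl1 : lam ≤ 1 / 2) :
    IsometricToSubspaceOfLp 1 (SpoiledSpace n lam) ↔ lam ≤ alphaBound n := by
  obtain ⟨C, hC, hrep⟩ := integral_oneDensity (n := n) (by omega)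
  rw [isometricToSubspaceOfLp_iff_of_zonal_density (by omega) (p := 1) (by simp) le_rfl
    (f := oneDensity n lam) (by unfold oneDensity; fun_prop) 2 hC
    (by simpa only [ENNReal.toReal_one] using hrep lam)
    (fun h t ht => by
      have h0 : 0 ≤ oneDensity n lam 0 := by
        -- The numerator `1 + 8λ - 20λ²` factors as `(1 - 2λ)(1 + 10λ)`, nonnegative for `λ ≤ 1/2`.
        simp only [oneDensity, mul_zero, add_zero, zero_pow two_ne_zero]
        exact div_nonneg (by nlinarith) (by positivity)
      -- Concavity made explicit: the density lies above its chord, so its two end values decide the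
      -- sign.
      have hconc : oneDensity n lam t = (1 - t) * oneDensity n lam 0 + t * oneDensity n lam 1 +
          9 * lam ^ 2 * (t * (1 - t)) := by
        unfold oneDensity; ring
      have := mul_nonneg ht.1 (sub_nonneg.2 ht.2)
      have := mul_nonneg (sub_nonneg.2 ht.2) h0
      have := mul_nonneg ht.1 h
      rw [hconc]
      positivity)]
  rw [oneDensity_one, le_div_iff₀ (by positivity), zero_mul, neg_nonneg,
    le_alphaBound_iff hn hl0]

end

theorem theorem1 (n : ℕ) (hn : 3 ≤ n) :
    (alphaBound n < 1 / (6 * (n : ℝ) - 4)) ∧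
    (∀ lam : ℝ, alphaBound n < lam → lam ≤ 1 / (6 * (n : ℝ) - 4) →
      NormedSpace.Core ℝ (SpoiledSpace n lam) ∧
      IsometricToSubspaceOfLp (1 / 2) (SpoiledSpace n lam) ∧
      ¬ IsometricToSubspaceOfLp 1 (SpoiledSpace n lam)) ∧
    (∀ lam : ℝ, 0 < lam → lam ≤ 1 / 11 →
      NormedSpace.Core ℝ (SpoiledSpace n lam) ∧
      (IsometricToSubspaceOfLp (1 / 2) (SpoiledSpace n lam) ↔ lam ≤ 1 / (6 * (n : ℝ) - 4)) ∧
      (IsometricToSubspaceOfLp 1 (SpoiledSpace n lam) ↔ lam ≤ alphaBound n)) := by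
  have main : ∀ lam : ℝ, 0 < lam → lam ≤ 1 / 11 →
      NormedSpace.Core ℝ (SpoiledSpace n lam) ∧
      (IsometricToSubspaceOfLp (1 / 2) (SpoiledSpace n lam) ↔ lam ≤ 1 / (6 * (n : ℝ) - 4)) ∧
      (IsometricToSubspaceOfLp 1 (SpoiledSpace n lam) ↔ lam ≤ alphaBound n) := fun lam h0 h1 =>
    ⟨normedSpaceCore_spoiledSpace n h0.le h1,
      isometricToSubspaceOfLp_half_iff hn h0.le (by linarith),
      isometricToSubspaceOfLp_one_iff hn h0 (by linarith)⟩
  refine ⟨alphaBound_lt hn, fun lam h0 h1 => ?_, main⟩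
  have hn3 : (3 : ℝ) ≤ n := by exact_mod_cast hn
  -- For `n ≥ 3`, `6n - 4 ≥ 14`.
  have h11 : lam ≤ 1 / 11 :=
    h1.trans (one_div_le_one_div_of_le (by norm_num) (by linarith))
  obtain ⟨hnorm, hhalf, hone⟩ := main lam ((alphaBound_pos_and_root hn).1.trans h0) h11
  exact ⟨hnorm, hhalf.2 h1, fun h => absurd (hone.1 h) (not_le.2 h0)⟩
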